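/- Let $\mathcal T=\{V,E,F\}$ be a triangulation of a closed connected surface $M$ (a simplicial complex with vertex set $V$, $|V|=N$), and let $\Phi:E\to[0,\pi/2]$ be edge weights. A circle packing metric is a function $r:V\to(0,\infty)$. It gives each edge the length $l_{ij}=\sqrt{r_i^2+r_j^2+2r_ir_j\cos\Phi_{ij}}$, and $\theta_i^{jk}$ denotes the angle at $i$ of the Euclidean triangle with side lengths $l_{ij},l_{jk},l_{ik}$. Put $$K_i=2\pi-\sum_{\{i,j,k\}\in F}\theta_i^{jk},\qquad R_i=\frac{K_i}{r_i^2},\qquad R_{av}=\frac{\sum_iR_ir_i^2}{\sum_ir_i^2}=\frac{2\pi\chi(M)}{\|r\|^2}.$$ With $u_j=\ln r_j^2$, the discrete Laplace operator at $r$ acts on functions $f:V\to\mathbb R$ by $$(\Delta f)_i=\frac1{r_i^2}\sum_{j\sim i}\Big(-\frac{\partial K_i}{\partial u_j}\Big)(f_j-f_i),$$ and $\lambda_1(-\Delta)$ is the smallest positive eigenvalue of $-\Delta$. The normalized combinatorial Ricci flow is the system $$\frac{dg_i}{dt}=(R_{av}-R_i)g_i,\qquad g_i=r_i^2,\quad i\in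 V.$$ A metric has constant curvature if $R_i$ does not depend on $i$. The solution $r(t)$ is said to converge if it exists for all $t\ge0$ and $r(t)\to r(\infty)$ as $t\to+\infty$ for some circle packing metric $r(\infty)\in\mathbb R^N_{>0}$. **Theorem.** Suppose that $\lambda_1(-\Delta)>R_{av}$ for every $r\in\mathbb R^N_{>0}$. Then, for every initial metric $r(0)\in\mathbb R^N_{>0}$, the solution to the normalized combinatorial Ricci flow converges if and only if there exists a constant curvature circle packing metric. Furthermore, if the solution converges, then its limit $r(\infty)$ has constant curvature and the convergence is exponential: there are $C,a>0$ such that $|r_i(t)-r_i(\infty)|\le Ce^{-at}$ for all $t\ge0$ and $i\in V$. -/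

import Mathlib

open Filter Topology

noncomputable section

/-- The graph of a family of triangles: two distinct vertices are joined by an edge
when they lie in a common triangle. -/
def oneSkeleton {V : Type*} (faces : Finset (Finset V)) : SimpleGraph V where
  Adj i j := i ≠ j ∧ ∃ f ∈ faces, i ∈ f ∧ j ∈ f
  symm := ⟨fun _ _ h => ⟨h.1.symm, h.2.imp fun _ hf => ⟨hf.1, hf.2.2, hf.2.1⟩⟩⟩
  loopless := ⟨fun _ h => h.1 rfl⟩

/-- The link of a vertex `v`: its vertices are the neighbours of `v`, and `a`, `b` are joined
when `{v, a, b}` is a triangle. -/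
def vertexLink {V : Type*} [DecidableEq V] (faces : Finset (Finset V)) (v : V) :
    SimpleGraph {w : V // (oneSkeleton faces).Adj v w} where
  Adj a b := a ≠ b ∧ ({v, a.1, b.1} : Finset V) ∈ faces
  symm := ⟨fun a b h => ⟨h.1.symm, by
    have : ({v, b.1, a.1} : Finset V) = {v, a.1, b.1} := by
      rw [Finset.pair_comm]
    rw [this]; exact h.2⟩⟩
  loopless := ⟨fun _ h => h.1 rfl⟩

/-- A triangulation of a closed connected surface with vertex set `V`, given by its triangles.
Every edge lies in exactly two triangles and every vertex link is nonempty and connected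
(so it is a single cycle, each vertex of the link having exactly two neighbours there). -/
structure TriangulatedSurface (V : Type*) [Fintype V] [DecidableEq V] where
  faces : Finset (Finset V)
  card_face : ∀ f ∈ faces, f.card = 3
  two_faces : ∀ i j : V, (oneSkeleton faces).Adj i j →
    (faces.filter fun f => i ∈ f ∧ j ∈ f).card = 2
  link_connected : ∀ v : V, (vertexLink faces v).Connected
  connected : (oneSkeleton faces).Connected

namespace TriangulatedSurface

variable {V : Type*} [Fintype V] [DecidableEq V]

/-- The graph of vertices and edges of the triangulation. -/
def graph (T : TriangulatedSurface V) : SimpleGraph V := oneSkeleton T.faces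

/-- The edge weights `Φ` take values in `[0, π/2]`.
Values of `Φ` on pairs that are not edges are irrelevant. -/
def IsWeight (T : TriangulatedSurface V) (Φ : Sym2 V → ℝ) : Prop :=
  ∀ e ∈ T.graph.edgeSet, 0 ≤ Φ e ∧ Φ e ≤ Real.pi / 2

end TriangulatedSurface

/-- A circle packing metric is a positive function on the vertices. -/
def IsCirclePackingMetric {V : Type*} (r : V → ℝ) : Prop := ∀ i, 0 < r i

/-- The length `l_ij` of the edge `ij`. -/
def edgeLength {V : Type*} (Φ : Sym2 V → ℝ) (r : V → ℝ) (i j : V) : ℝ :=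
  Real.sqrt (r i ^ 2 + r j ^ 2 + 2 * r i * r j * Real.cos (Φ s(i, j)))

/-- The inner angle at `i` of the Euclidean triangle with side lengths `l_ij`, `l_jk`, `l_ik`. -/
def innerAngle {V : Type*} (Φ : Sym2 V → ℝ) (r : V → ℝ) (i j k : V) : ℝ :=
  Real.arccos ((edgeLength Φ r i j ^ 2 + edgeLength Φ r i k ^ 2 - edgeLength Φ r j k ^ 2) /
    (2 * edgeLength Φ r i j * edgeLength Φ r i k))

namespace TriangulatedSurface

variable {V : Type*} [Fintype V] [DecidableEq V]

/-- The classical discrete Gauss curvature `K_i`: the angle deficit at `i`. Each triangle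
`{i, j, k}` at `i` is counted twice in the sum over ordered pairs `(j, k)`, whence the `1 / 2`
(a set `{i, j, k}` that is a face has three elements, so `i`, `j`, `k` are distinct). -/
def angleDeficit (T : TriangulatedSurface V) (Φ : Sym2 V → ℝ) (r : V → ℝ) (i : V) : ℝ :=
  2 * Real.pi - (1 / 2) * ∑ j : V, ∑ k : V,
    if ({i, j, k} : Finset V) ∈ T.faces then innerAngle Φ r i j k else 0

/-- The `R`-curvature `R_i = K_i / r_i ^ 2`. -/
def curvature (T : TriangulatedSurface V) (Φ : Sym2 V → ℝ) (r : V → ℝ) (i : V) : ℝ :=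
  T.angleDeficit Φ r i / r i ^ 2

/-- The average of the `R`-curvature with respect to the measure `μ_i = r_i ^ 2`. -/
def averageCurvature (T : TriangulatedSurface V) (Φ : Sym2 V → ℝ) (r : V → ℝ) : ℝ :=
  (∑ i, T.curvature Φ r i * r i ^ 2) / ∑ i, r i ^ 2

/-- The partial derivative `∂K_i/∂u_j` at the metric `r`, in the coordinates
`u_k = log (r_k ^ 2)`, that is, `r_k = exp (u_k / 2)`. -/
def angleDeficitDeriv (T : TriangulatedSurface V) (Φ : Sym2 V → ℝ) (r : V → ℝ) (i j : V) : ℝ :=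
  let u : V → ℝ := fun k => Real.log (r k ^ 2)
  deriv (fun s : ℝ => T.angleDeficit Φ (fun k => Real.exp (Function.update u j s k / 2)) i) (u j)

open Classical in
/-- The discrete Laplace operator
`(Δ f)_i = (1 / r_i ^ 2) * ∑_{j ∼ i} (- ∂K_i/∂u_j) * (f_j - f_i)`. -/
def laplacian (T : TriangulatedSurface V) (Φ : Sym2 V → ℝ) (r : V → ℝ) :
    (V → ℝ) →ₗ[ℝ] (V → ℝ) where
  toFun f i := (1 / r i ^ 2) *
    ∑ j ∈ Finset.univ.filter (fun j => T.graph.Adj i j),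
      (-T.angleDeficitDeriv Φ r i j) * (f j - f i)
  map_add' f g := by
    funext i
    simp only [Pi.add_apply]
    rw [← mul_add, ← Finset.sum_add_distrib]
    exact congrArg _ (Finset.sum_congr rfl fun j _ => by ring)
  map_smul' c f := by
    funext i
    simp only [Pi.smul_apply, smul_eq_mul, RingHom.id_apply]
    rw [mul_left_comm c, Finset.mul_sum _ _ c]
    exact congrArg _ (Finset.sum_congr rfl fun j _ => by ring)

/-- The first positive eigenvalue `λ₁(-Δ)`: the least of the positive eigenvalues of `-Δ`. -/
def firstPositiveEigenvalue (T : TriangulatedSurface V) (Φ : Sym2 V → ℝ) (r : V → ℝ) : ℝ :=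
  sInf {μ : ℝ | 0 < μ ∧ Module.End.HasEigenvalue (-T.laplacian Φ r) μ}

/-- `r` is a circle packing metric whose `R`-curvature is the same at all vertices. -/
def IsConstantCurvatureMetric (T : TriangulatedSurface V) (Φ : Sym2 V → ℝ) (r : V → ℝ) : Prop :=
  IsCirclePackingMetric r ∧ ∃ c : ℝ, ∀ i, T.curvature Φ r i = c

/-- `r` solves the normalized combinatorial Ricci flow `dg_i/dt = (R_av - R_i) g_i`,
`g_i = r_i ^ 2`, for all times `t ≥ 0`, with initial metric `r₀`.
(Values of `r` at negative times are irrelevant.) -/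
structure IsNormalizedRicciFlow (T : TriangulatedSurface V) (Φ : Sym2 V → ℝ)
    (r₀ : V → ℝ) (r : ℝ → V → ℝ) : Prop where
  initial : r 0 = r₀
  isMetric : ∀ t : ℝ, 0 ≤ t → IsCirclePackingMetric (r t)
  evolution : ∀ t : ℝ, 0 ≤ t → ∀ i : V,
    HasDerivWithinAt (fun s => r s i ^ 2)
      ((T.averageCurvature Φ (r t) - T.curvature Φ (r t) i) * r t i ^ 2) (Set.Ici 0) t

end TriangulatedSurface

end

/-! Put `u i = log (r i ^ 2)` and `G = curvatureDefect`, so that `G u i = K_i - R_av * exp (u i)`.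
The flow becomes `u' i = -exp (-u i) * G u i`; its stationary points are the constant curvature
metrics, and the total area `∑ i, exp (u i)` is conserved.

In one triangle ∂θ_i/∂u_j = ∂θ_j/∂u_i ≥ 0 (`innerAngleWeight_swap`, `angleWeight_nonneg`), so the
Jacobian of `K` is the Laplacian of a graph with nonnegative conductances. The Jacobian of `G` is
this Laplacian minus `R_av` times a weighted variance form (`fderiv_curvatureDefect`). It is
symmetric, so `G` is the gradient of a potential `F`. By the Poincaré inequality
`dirichlet_gt_of_eigenvalues_gt`, the condition λ₁ > R_av makes it positive in every nonconstant
direction.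

Metrics of equal area differ by an element of `mixedSignCone`, a closed cone whose only constant
element is 0, so on it the Hessian of `F` is uniformly positive over bounded sets. If `G` has a zero
`u₀` of the given area, `F` is proper on `u₀ + mixedSignCone` and decreases along the flow, which is
thus trapped and exists for all times (`exists_bounded_flow`). There `F - F u₀` bounds the squared
distance to `u₀` and is bounded by the squared gradient, whence exponential decay
(`exists_exp_decay`). Conversely, a limit of the flow is a zero of `G`, because the derivative of `r
i ^ 2` converges as well. -/

noncomputable section

/-! ### One triangle of circles: nondegeneracy and derivatives of the angles. -/

/-- The square of the distance of the centres of two circles of radii `x`, `y` whose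
intersection angle has cosine `c`. -/
def lengthSq (x y c : ℝ) : ℝ := x ^ 2 + y ^ 2 + 2 * x * y * c

/-- Sixteen times the squared area of the triangle of centres of three circles of radii
`x`, `y`, `z`, where `a`, `b`, `c` are the cosines for the pairs `yz`, `xz`, `xy`. -/
def heronDisc (x y z a b c : ℝ) : ℝ :=
  4 * lengthSq x z b * lengthSq x y c -
    (lengthSq x z b + lengthSq x y c - lengthSq y z a) ^ 2

/-- The derivative of the angle at the centre of the circle of radius `x` with respect to
`log (y ^ 2)`. -/
def angleWeight (x y z a b c : ℝ) : ℝ :=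
  x * y * (x * y * (1 - c ^ 2) + z * x * (a + b * c) + z * y * (b + a * c)) /
    (√(heronDisc x y z a b c) * lengthSq x y c)

lemma lengthSq_comm (x y c : ℝ) : lengthSq x y c = lengthSq y x c := by
  unfold lengthSq; ring

lemma lengthSq_pos {x y c : ℝ} (hx : 0 < x) (hy : 0 < y) (hc : 0 ≤ c) : 0 < lengthSq x y c := by
  unfold lengthSq; positivity

lemma heronDisc_swap (x y z a b c : ℝ) : heronDisc y x z b a c = heronDisc x y z a b c := by
  unfold heronDisc lengthSq; ring

lemma heronDisc_rotate (x y z a b c : ℝ) : heronDisc x z y a c b = heronDisc x y z a b c := by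
  unfold heronDisc lengthSq; ring_nf

lemma angleWeight_swap (x y z a b c : ℝ) : angleWeight y x z b a c = angleWeight x y z a b c := by
  unfold angleWeight
  rw [heronDisc_swap, lengthSq_comm y x]
  congr 1; ring

/-- For cosines in `[0, 1]`, that is, weights in `[0, π/2]`, all coefficients of this form are
nonnegative. Hence three circles always span a nondegenerate triangle. -/
lemma heronDisc_eq (x y z a b c : ℝ) : heronDisc x y z a b c =
    4 * (x ^ 2 * y ^ 2 * (1 - c ^ 2) + x ^ 2 * z ^ 2 * (1 - b ^ 2) + y ^ 2 * z ^ 2 * (1 - a ^ 2)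
      + 2 * x ^ 2 * (y * z) * (a + b * c) + 2 * y ^ 2 * (x * z) * (b + a * c)
      + 2 * z ^ 2 * (x * y) * (c + a * b)) := by
  unfold heronDisc lengthSq; ring

lemma one_sub_sq_nonneg {c : ℝ} (hc : c ∈ Set.Icc (0 : ℝ) 1) : 0 ≤ 1 - c ^ 2 := by
  nlinarith [hc.1, hc.2]

lemma heronDisc_pos {x y z a b c : ℝ} (hx : 0 < x) (hy : 0 < y) (hz : 0 < z)
    (ha : a ∈ Set.Icc (0 : ℝ) 1) (hb : b ∈ Set.Icc (0 : ℝ) 1) (hc : c ∈ Set.Icc (0 : ℝ) 1) :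
    0 < heronDisc x y z a b c := by
  rw [heronDisc_eq]
  have h1 := one_sub_sq_nonneg ha
  have h2 := one_sub_sq_nonneg hb
  have h3 := one_sub_sq_nonneg hc
  obtain ⟨ha0, -⟩ := ha
  obtain ⟨hb0, -⟩ := hb
  obtain ⟨hc0, -⟩ := hc
  rcases ha0.eq_or_lt with rfl | ha0
  · have : 0 < y ^ 2 * z ^ 2 * (1 - 0 ^ 2) := by simp; positivity
    positivity
  · have : 0 < 2 * x ^ 2 * (y * z) * (a + b * c) := by positivity
    positivity

lemma angleWeight_nonneg {x y z a b c : ℝ} (hx : 0 < x) (hy : 0 < y) (hz : 0 < z)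
    (ha : a ∈ Set.Icc (0 : ℝ) 1) (hb : b ∈ Set.Icc (0 : ℝ) 1) (hc : c ∈ Set.Icc (0 : ℝ) 1) :
    0 ≤ angleWeight x y z a b c := by
  have h3 := one_sub_sq_nonneg hc
  have := lengthSq_pos hx hy hc.1
  obtain ⟨ha0, -⟩ := ha
  obtain ⟨hb0, -⟩ := hb
  obtain ⟨hc0, -⟩ := hc
  unfold angleWeight
  positivity

/-- The excluded case `a = b = 0`, `c = 1` (weights π/2, π/2, 0) is admissible, and there the
numerator vanishes. An edge may thus have conductance zero, and connectedness needs
`angleWeight_pos_or`. -/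
lemma angleWeight_pos {x y z a b c : ℝ} (hx : 0 < x) (hy : 0 < y) (hz : 0 < z)
    (ha : a ∈ Set.Icc (0 : ℝ) 1) (hb : b ∈ Set.Icc (0 : ℝ) 1) (hc : c ∈ Set.Icc (0 : ℝ) 1)
    (h : 0 < a + b ∨ c < 1) : 0 < angleWeight x y z a b c := by
  have h3 := one_sub_sq_nonneg hc
  have := lengthSq_pos hx hy hc.1
  have hd := Real.sqrt_pos.2 (heronDisc_pos hx hy hz ha hb hc)
  obtain ⟨ha0, -⟩ := ha
  obtain ⟨hb0, -⟩ := hb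
  obtain ⟨hc0, hc1⟩ := hc
  unfold angleWeight
  refine div_pos (mul_pos (by positivity) ?_) (by positivity)
  rcases h with h | h
  · rcases ha0.eq_or_lt with rfl | ha0
    · have : 0 < z * y * (b + 0 * c) := by
        have : 0 < b := by linarith
        positivity
      positivity
    · have : 0 < z * x * (a + b * c) := by positivity
      positivity
  · have : 0 < 1 - c ^ 2 := by nlinarith
    positivity

/-- At most one of the three weights of a triangle vanishes. -/
lemma angleWeight_pos_or {x y z a b c : ℝ} (hx : 0 < x) (hy : 0 < y) (hz : 0 < z)
    (ha : a ∈ Set.Icc (0 : ℝ) 1) (hb : b ∈ Set.Icc (0 : ℝ) 1) (hc : c ∈ Set.Icc (0 : ℝ) 1) :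
    0 < angleWeight x y z a b c ∨
      (0 < angleWeight x z y a c b ∧ 0 < angleWeight y z x b c a) := by
  by_cases h : 0 < a + b ∨ c < 1
  · exact .inl (angleWeight_pos hx hy hz ha hb hc h)
  · push Not at h
    have hc1 : 0 < c := by linarith
    exact .inr ⟨angleWeight_pos hx hz hy ha hc hb (.inl (by linarith [ha.1])),
      angleWeight_pos hy hz hx hb hc ha (.inl (by linarith [hb.1]))⟩

/-- With `A`, `B`, `C` the squared side lengths, the numerator on the right is sixteen times the
squared area. Its positivity keeps the cosine away from ±1, where `arccos` is not differentiable. -/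
lemma one_sub_cosineLaw_sq {A B C : ℝ} (hB : 0 < B) (hC : 0 < C) :
    1 - ((C + B - A) / (2 * √C * √B)) ^ 2 =
      (4 * B * C - (B + C - A) ^ 2) / (2 * √C * √B) ^ 2 := by
  have hb := Real.sqrt_pos.2 hB
  have hc := Real.sqrt_pos.2 hC
  rw [eq_div_iff (by positivity), sub_mul, div_pow, div_mul_cancel₀ _ (by positivity), mul_pow,
    mul_pow, Real.sq_sqrt hB.le, Real.sq_sqrt hC.le]
  ring

lemma cosineLaw_sq_lt_one {A B C : ℝ} (hB : 0 < B) (hC : 0 < C)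
    (hD : 0 < 4 * B * C - (B + C - A) ^ 2) : ((C + B - A) / (2 * √C * √B)) ^ 2 < 1 := by
  have hb := Real.sqrt_pos.2 hB
  have hc := Real.sqrt_pos.2 hC
  have := one_sub_cosineLaw_sq (A := A) hB hC
  have : 0 < (4 * B * C - (B + C - A) ^ 2) / (2 * √C * √B) ^ 2 := by positivity
  linarith

lemma ne_of_sq_lt_one {x : ℝ} (h : x ^ 2 < 1) : x ≠ -1 ∧ x ≠ 1 :=
  ⟨by rintro rfl; norm_num at h, by rintro rfl; norm_num at h⟩

lemma hasDerivAt_arccos_cosineLaw {A B C : ℝ → ℝ} {A' B' C' s : ℝ} (hA : HasDerivAt A A' s)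
    (hB : HasDerivAt B B' s) (hC : HasDerivAt C C' s) (hB0 : 0 < B s) (hC0 : 0 < C s)
    (hD : 0 < 4 * B s * C s - (B s + C s - A s) ^ 2) :
    HasDerivAt (fun s => Real.arccos ((C s + B s - A s) / (2 * √(C s) * √(B s))))
      ((A' - B' - C' + (B s + C s - A s) * (B' / (2 * B s) + C' / (2 * C s))) /
        √(4 * B s * C s - (B s + C s - A s) ^ 2)) s := by
  have hb := Real.sqrt_pos.2 hB0
  have hc := Real.sqrt_pos.2 hC0
  have hne := ne_of_sq_lt_one (cosineLaw_sq_lt_one hB0 hC0 hD)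
  have hq : HasDerivAt (fun s => (C s + B s - A s) / (2 * √(C s) * √(B s))) _ s :=
    ((hC.add hB).sub hA).div (((hC.sqrt hC0.ne').const_mul 2).mul (hB.sqrt hB0.ne'))
      (by positivity : 2 * √(C s) * √(B s) ≠ 0)
  have h := (Real.hasDerivAt_arccos hne.1 hne.2).comp s hq
  refine h.congr_deriv ?_
  simp only [Pi.add_apply, Pi.sub_apply]
  rw [one_sub_cosineLaw_sq hB0 hC0, Real.sqrt_div hD.le, Real.sqrt_sq (by positivity)]
  have hd := Real.sqrt_pos.2 hD
  have hb2 := Real.sq_sqrt hB0.le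
  have hc2 := Real.sq_sqrt hC0.le
  set d := √(4 * B s * C s - (B s + C s - A s) ^ 2)
  rw [← hb2, ← hc2]
  simp only [Real.sqrt_sq hb.le, Real.sqrt_sq hc.le]
  generalize √(B s) = β at *
  generalize √(C s) = γ at *
  field_simp
  ring

/-- Variation of the angle of a triangle of circles under a change of the logarithms of the
squared radii. -/
lemma angleVariation_eq {x y z a b c p q r : ℝ} (hx : 0 < x) (hy : 0 < y) (hz : 0 < z)
    (ha : a ∈ Set.Icc (0 : ℝ) 1) (hb : b ∈ Set.Icc (0 : ℝ) 1) (hc : c ∈ Set.Icc (0 : ℝ) 1) :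
    ((q * (y ^ 2 + y * z * a) + r * (z ^ 2 + y * z * a)) -
      (p * (x ^ 2 + x * z * b) + r * (z ^ 2 + x * z * b)) -
      (p * (x ^ 2 + x * y * c) + q * (y ^ 2 + x * y * c)) +
      (lengthSq x z b + lengthSq x y c - lengthSq y z a) *
        ((p * (x ^ 2 + x * z * b) + r * (z ^ 2 + x * z * b)) / (2 * lengthSq x z b) +
          (p * (x ^ 2 + x * y * c) + q * (y ^ 2 + x * y * c)) / (2 * lengthSq x y c))) /
      √(4 * lengthSq x z b * lengthSq x y c -
        (lengthSq x z b + lengthSq x y c - lengthSq y z a) ^ 2) =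
    angleWeight x y z a b c * (q - p) + angleWeight x z y a c b * (r - p) := by
  have hd := Real.sqrt_pos.2 (heronDisc_pos hx hy hz ha hb hc)
  have hB := lengthSq_pos hx hz hb.1
  have hC := lengthSq_pos hx hy hc.1
  unfold angleWeight
  -- Both weights contain the same area; with it as a free variable `d`, the claim is a rational
  -- identity.
  rw [heronDisc_rotate x y z]
  change _ / √(heronDisc x y z a b c) = _
  generalize √(heronDisc x y z a b c) = d at *
  field_simp
  unfold lengthSq
  ring

/-! ### Angles in logarithmic coordinates. -/

/-- The circle packing metric with logarithmic coordinates `u i = log (r i ^ 2)`. -/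
def metricOfLog {V : Type*} (u : V → ℝ) : V → ℝ := fun k => Real.exp (u k / 2)

section metric

variable {V : Type*}

lemma metricOfLog_pos (u : V → ℝ) : IsCirclePackingMetric (metricOfLog u) := fun _ =>
  Real.exp_pos _

lemma metricOfLog_sq (u : V → ℝ) (i : V) : metricOfLog u i ^ 2 = Real.exp (u i) := by
  rw [metricOfLog, ← Real.exp_nat_mul]
  congr 1
  push_cast
  ring

lemma metricOfLog_log {r : V → ℝ} (hr : IsCirclePackingMetric r) :
    metricOfLog (fun i => Real.log (r i ^ 2)) = r := by
  funext i
  rw [metricOfLog, Real.log_pow, show ((2 : ℕ) : ℝ) * Real.log (r i) / 2 = Real.log (r i) by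
    push_cast; ring, Real.exp_log (hr i)]

lemma metricOfLog_add_const (u : V → ℝ) (c : ℝ) :
    metricOfLog (fun i => u i + c) = fun i => Real.exp (c / 2) * metricOfLog u i := by
  funext i
  rw [metricOfLog, metricOfLog, ← Real.exp_add]
  congr 1
  ring

/-- The cosine of the weight of the edge `ij`. -/
def cosWeight (Φ : Sym2 V → ℝ) (i j : V) : ℝ := Real.cos (Φ s(i, j))

lemma cosWeight_comm (Φ : Sym2 V → ℝ) (i j : V) : cosWeight Φ i j = cosWeight Φ j i := by
  rw [cosWeight, Sym2.eq_swap, cosWeight]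

lemma edgeLength_eq (Φ : Sym2 V → ℝ) (r : V → ℝ) (i j : V) :
    edgeLength Φ r i j = √(lengthSq (r i) (r j) (cosWeight Φ i j)) := rfl

/-- The weights of the three sides of `ijk` lie in the range where circles packed with these
weights form a triangle. -/
structure IsTriangleWeight (Φ : Sym2 V → ℝ) (i j k : V) : Prop where
  cos_jk : cosWeight Φ j k ∈ Set.Icc (0 : ℝ) 1
  cos_ik : cosWeight Φ i k ∈ Set.Icc (0 : ℝ) 1
  cos_ij : cosWeight Φ i j ∈ Set.Icc (0 : ℝ) 1

lemma innerAngle_eq {Φ : Sym2 V → ℝ} {i j k : V} (h : IsTriangleWeight Φ i j k) {r : V → ℝ}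
    (hr : IsCirclePackingMetric r) :
    innerAngle Φ r i j k =
      Real.arccos ((lengthSq (r i) (r j) (cosWeight Φ i j) + lengthSq (r i) (r k) (cosWeight Φ i k)
        - lengthSq (r j) (r k) (cosWeight Φ j k)) /
        (2 * √(lengthSq (r i) (r j) (cosWeight Φ i j)) *
          √(lengthSq (r i) (r k) (cosWeight Φ i k)))) := by
  rw [innerAngle, edgeLength_eq, edgeLength_eq, edgeLength_eq,
    Real.sq_sqrt (lengthSq_pos (hr i) (hr j) h.cos_ij.1).le,
    Real.sq_sqrt (lengthSq_pos (hr i) (hr k) h.cos_ik.1).le,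
    Real.sq_sqrt (lengthSq_pos (hr j) (hr k) h.cos_jk.1).le]

lemma innerAngle_mul {Φ : Sym2 V → ℝ} {i j k : V} {r : V → ℝ} {c : ℝ} (hc : 0 < c) :
    innerAngle Φ (fun i => c * r i) i j k = innerAngle Φ r i j k := by
  have h (i j : V) : edgeLength Φ (fun i => c * r i) i j = c * edgeLength Φ r i j := by
    rw [edgeLength, edgeLength, show (c * r i) ^ 2 + (c * r j) ^ 2 +
      2 * (c * r i) * (c * r j) * Real.cos (Φ s(i, j)) =
      c ^ 2 * (r i ^ 2 + r j ^ 2 + 2 * r i * r j * Real.cos (Φ s(i, j))) by ring,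
      Real.sqrt_mul (by positivity), Real.sqrt_sq hc.le]
  simp only [innerAngle, h]
  congr 1
  rw [show (c * edgeLength Φ r i j) ^ 2 + (c * edgeLength Φ r i k) ^ 2 -
    (c * edgeLength Φ r j k) ^ 2 =
    c ^ 2 * (edgeLength Φ r i j ^ 2 + edgeLength Φ r i k ^ 2 - edgeLength Φ r j k ^ 2) by ring,
    show 2 * (c * edgeLength Φ r i j) * (c * edgeLength Φ r i k) =
      c ^ 2 * (2 * edgeLength Φ r i j * edgeLength Φ r i k) by ring,
    mul_div_mul_left _ _ (by positivity)]

/-- The derivative of the angle at `i` of the triangle `ijk` with respect to `log (r j ^ 2)`. -/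
def innerAngleWeight (Φ : Sym2 V → ℝ) (r : V → ℝ) (i j k : V) : ℝ :=
  angleWeight (r i) (r j) (r k) (cosWeight Φ j k) (cosWeight Φ i k) (cosWeight Φ i j)

/-- This reciprocity ∂θ_i/∂u_j = ∂θ_j/∂u_i is what makes the curvature a gradient. -/
lemma innerAngleWeight_swap (Φ : Sym2 V → ℝ) (r : V → ℝ) (i j k : V) :
    innerAngleWeight Φ r j i k = innerAngleWeight Φ r i j k := by
  rw [innerAngleWeight, cosWeight_comm Φ j i, angleWeight_swap, innerAngleWeight]

/-- Only differences of the components of `v` enter, since angles do not change under scaling. -/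
lemma hasDerivAt_innerAngle {Φ : Sym2 V → ℝ} {i j k : V} (h : IsTriangleWeight Φ i j k)
    {u : ℝ → V → ℝ} {v : V → ℝ} {s : ℝ} (hu : ∀ k, HasDerivAt (fun t => u t k) (v k) s) :
    HasDerivAt (fun t => innerAngle Φ (metricOfLog (u t)) i j k)
      (innerAngleWeight Φ (metricOfLog (u s)) i j k * (v j - v i) +
        innerAngleWeight Φ (metricOfLog (u s)) i k j * (v k - v i)) s := by
  simp only [innerAngle_eq h (metricOfLog_pos _)]
  have hr (k : V) : HasDerivAt (fun t => metricOfLog (u t) k)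
      (metricOfLog (u s) k * v k / 2) s :=
    ((hu k).div_const 2).exp.congr_deriv (by rw [metricOfLog]; ring)
  have hl (i j : V) (c : ℝ) : HasDerivAt
      (fun t => lengthSq (metricOfLog (u t) i) (metricOfLog (u t) j) c)
      (v i * (metricOfLog (u s) i ^ 2 + metricOfLog (u s) i * metricOfLog (u s) j * c) +
        v j * (metricOfLog (u s) j ^ 2 + metricOfLog (u s) i * metricOfLog (u s) j * c)) s :=
    ((((hr i).pow 2).add ((hr j).pow 2)).add
      ((((hr i).const_mul 2).mul (hr j)).mul_const c)).congr_deriv (by push_cast; ring)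
  have hp := metricOfLog_pos (u s)
  refine (hasDerivAt_arccos_cosineLaw (hl j k _) (hl i k _) (hl i j _)
    (lengthSq_pos (hp i) (hp k) h.cos_ik.1) (lengthSq_pos (hp i) (hp j) h.cos_ij.1)
    (heronDisc_pos (hp i) (hp j) (hp k) h.cos_jk h.cos_ik h.cos_ij)).congr_deriv ?_
  rw [angleVariation_eq (hp i) (hp j) (hp k) h.cos_jk h.cos_ik h.cos_ij, innerAngleWeight,
    innerAngleWeight, cosWeight_comm Φ k j]

variable [Fintype V]

lemma contDiff_innerAngle {Φ : Sym2 V → ℝ} {i j k : V} (h : IsTriangleWeight Φ i j k)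
    {n : WithTop ℕ∞} : ContDiff ℝ n fun u : V → ℝ => innerAngle Φ (metricOfLog u) i j k := by
  simp only [innerAngle_eq h (metricOfLog_pos _)]
  have hr (k : V) : ContDiff ℝ n fun u : V → ℝ => metricOfLog u k := by
    unfold metricOfLog; fun_prop
  have hl (i j : V) (c : ℝ) : ContDiff ℝ n
      fun u : V → ℝ => lengthSq (metricOfLog u i) (metricOfLog u j) c := by
    have h1 := hr i
    have h2 := hr j
    unfold lengthSq
    fun_prop
  rw [contDiff_iff_contDiffAt]
  intro u
  have hp := metricOfLog_pos u
  have hC := lengthSq_pos (hp i) (hp j) h.cos_ij.1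
  have hB := lengthSq_pos (hp i) (hp k) h.cos_ik.1
  have hne := ne_of_sq_lt_one (cosineLaw_sq_lt_one hB hC
    (heronDisc_pos (hp i) (hp j) (hp k) h.cos_jk h.cos_ik h.cos_ij))
  refine ContDiffAt.comp (g := Real.arccos) u (Real.contDiffAt_arccos hne.1 hne.2) (ContDiffAt.div ?_ ?_ ?_)
  · exact (((hl i j _).add (hl i k _)).sub (hl j k _)).contDiffAt
  · exact (contDiffAt_const.mul ((hl i j _).contDiffAt.sqrt hC.ne')).mul
      ((hl i k _).contDiffAt.sqrt hB.ne')
  · have := Real.sqrt_pos.2 hB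
    have := Real.sqrt_pos.2 hC
    positivity

end metric

/-! ### Conductances, the variation of the curvature, and the Laplacian. -/

namespace TriangulatedSurface

variable {V : Type*} [Fintype V] [DecidableEq V] {T : TriangulatedSurface V} {Φ : Sym2 V → ℝ}

lemma graph_adj_of_mem_faces {i j k : V} (h : ({i, j, k} : Finset V) ∈ T.faces) :
    T.graph.Adj i j := by
  refine ⟨?_, _, h, by simp, by simp⟩
  rintro rfl
  have h1 := T.card_face _ h
  rw [Finset.insert_eq_of_mem (by simp)] at h1
  have := Finset.card_le_two (a := i) (b := k)
  omega

lemma mem_faces_rotate {i j k : V} :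
    ({i, k, j} : Finset V) ∈ T.faces ↔ ({i, j, k} : Finset V) ∈ T.faces := by
  rw [Finset.pair_comm]

lemma mem_faces_swap {i j k : V} :
    ({j, i, k} : Finset V) ∈ T.faces ↔ ({i, j, k} : Finset V) ∈ T.faces := by
  rw [Finset.insert_comm]

lemma exists_face_of_adj {i j : V} (h : T.graph.Adj i j) :
    ∃ k, ({i, j, k} : Finset V) ∈ T.faces := by
  obtain ⟨hij, f, hf, hi, hj⟩ := h
  obtain ⟨a, b, c, hab, hac, hbc, rfl⟩ := Finset.card_eq_three.1 (T.card_face f hf)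
  have hsub : ({i, j} : Finset V) ⊆ {a, b, c} := by
    simp [Finset.insert_subset_iff, hi, hj] at *
  obtain ⟨k, hk⟩ := Finset.card_eq_one.1 (show (({a, b, c} : Finset V) \ {i, j}).card = 1 by
    rw [Finset.card_sdiff_of_subset hsub, Finset.card_pair hij, T.card_face _ hf])
  refine ⟨k, ?_⟩
  have : ({i, j, k} : Finset V) = {a, b, c} := by
    rw [← Finset.sdiff_union_of_subset hsub, hk]
    ext x; simp; tauto
  rwa [this]

lemma IsWeight.cosWeight_mem (hΦ : T.IsWeight Φ) {i j : V} (h : T.graph.Adj i j) :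
    cosWeight Φ i j ∈ Set.Icc (0 : ℝ) 1 := by
  obtain ⟨h0, h1⟩ := hΦ s(i, j) h
  exact ⟨Real.cos_nonneg_of_neg_pi_div_two_le_of_le (by linarith [Real.pi_pos]) h1,
    Real.cos_le_one _⟩

lemma IsWeight.isTriangleWeight (hΦ : T.IsWeight Φ) {i j k : V}
    (h : ({i, j, k} : Finset V) ∈ T.faces) : IsTriangleWeight Φ i j k where
  cos_jk := hΦ.cosWeight_mem <| graph_adj_of_mem_faces
    (mem_faces_rotate.1 (mem_faces_swap.1 h))
  cos_ik := hΦ.cosWeight_mem <| graph_adj_of_mem_faces (mem_faces_rotate.1 h)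
  cos_ij := hΦ.cosWeight_mem <| graph_adj_of_mem_faces h

variable (T Φ) in
/-- The negative of `∂K_i/∂u_j` for `j ≠ i`. -/
def edgeConductance (r : V → ℝ) (i j : V) : ℝ :=
  ∑ k, if ({i, j, k} : Finset V) ∈ T.faces then innerAngleWeight Φ r i j k else 0

lemma edgeConductance_comm (r : V → ℝ) (i j : V) :
    T.edgeConductance Φ r i j = T.edgeConductance Φ r j i := by
  unfold edgeConductance
  refine Finset.sum_congr rfl fun k _ => ?_
  simp only [mem_faces_swap (i := i) (j := j), innerAngleWeight_swap Φ r i j]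

lemma edgeConductance_eq_zero (r : V → ℝ) {i j : V} (h : ¬ T.graph.Adj i j) :
    T.edgeConductance Φ r i j = 0 :=
  Finset.sum_eq_zero fun _ _ => if_neg fun hf => h (graph_adj_of_mem_faces hf)

lemma innerAngleWeight_nonneg (hΦ : T.IsWeight Φ) {r : V → ℝ} (hr : IsCirclePackingMetric r)
    {i j k : V} (h : ({i, j, k} : Finset V) ∈ T.faces) : 0 ≤ innerAngleWeight Φ r i j k :=
  have ht := hΦ.isTriangleWeight h
  angleWeight_nonneg (hr i) (hr j) (hr k) ht.cos_jk ht.cos_ik ht.cos_ij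

lemma edgeConductance_nonneg (hΦ : T.IsWeight Φ) {r : V → ℝ} (hr : IsCirclePackingMetric r)
    (i j : V) : 0 ≤ T.edgeConductance Φ r i j :=
  Finset.sum_nonneg fun k _ => by
    split_ifs with h
    exacts [innerAngleWeight_nonneg hΦ hr h, le_rfl]

lemma edgeConductance_pos (hΦ : T.IsWeight Φ) {r : V → ℝ} (hr : IsCirclePackingMetric r)
    {i j k : V} (h : ({i, j, k} : Finset V) ∈ T.faces) (hw : 0 < innerAngleWeight Φ r i j k) :
    0 < T.edgeConductance Φ r i j :=
  Finset.sum_pos' (fun k _ => by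
    split_ifs with h
    exacts [innerAngleWeight_nonneg hΦ hr h, le_rfl]) ⟨k, Finset.mem_univ _, by rwa [if_pos h]⟩

/-- The edges of positive conductance still connect the surface. -/
lemma eq_of_conductance (hΦ : T.IsWeight Φ) {r : V → ℝ} (hr : IsCirclePackingMetric r)
    {f : V → ℝ} (hf : ∀ i j, 0 < T.edgeConductance Φ r i j → f i = f j) (i j : V) :
    f i = f j := by
  have hadj (i j : V) (h : T.graph.Adj i j) : f i = f j := by
    obtain ⟨k, hk⟩ := exists_face_of_adj h
    have ht := hΦ.isTriangleWeight hk
    -- Either the edge `ij` conducts, or both edges of the detour through `k` do.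
    rcases angleWeight_pos_or (hr i) (hr j) (hr k) ht.cos_jk ht.cos_ik ht.cos_ij with hw | ⟨hw, hw'⟩
    · exact hf i j (edgeConductance_pos hΦ hr hk hw)
    · rw [cosWeight_comm Φ j k] at hw
      rw [cosWeight_comm Φ i k, cosWeight_comm Φ i j] at hw'
      exact (hf i k (edgeConductance_pos hΦ hr (mem_faces_rotate.2 hk) hw)).trans
        (hf j k (edgeConductance_pos hΦ hr
          (mem_faces_rotate.2 (mem_faces_swap.2 hk)) hw')).symm
  obtain ⟨p⟩ := T.connected.preconnected i j
  induction p with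
  | nil => rfl
  | cons h _ ih => exact (hadj _ _ h).trans ih

lemma hasDerivAt_angleDeficit (hΦ : T.IsWeight Φ) {u : ℝ → V → ℝ} {v : V → ℝ} {s : ℝ}
    (hu : ∀ k, HasDerivAt (fun t => u t k) (v k) s) (i : V) :
    HasDerivAt (fun t => T.angleDeficit Φ (metricOfLog (u t)) i)
      (∑ j, T.edgeConductance Φ (metricOfLog (u s)) i j * (v i - v j)) s := by
  set r := metricOfLog (u s)
  have hterm (j k : V) : HasDerivAt
      (fun t => if ({i, j, k} : Finset V) ∈ T.faces then innerAngle Φ (metricOfLog (u t)) i j k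
        else 0)
      ((if ({i, j, k} : Finset V) ∈ T.faces then innerAngleWeight Φ r i j k else 0) * (v j - v i) +
        (if ({i, k, j} : Finset V) ∈ T.faces then innerAngleWeight Φ r i k j else 0) *
          (v k - v i)) s := by
    simp only [mem_faces_rotate (i := i) (j := j) (k := k)]
    split_ifs with h
    · exact hasDerivAt_innerAngle (hΦ.isTriangleWeight h) hu
    · simpa using hasDerivAt_const s (0 : ℝ)
  have h := ((HasDerivAt.fun_sum fun j (_ : j ∈ Finset.univ) =>
    HasDerivAt.fun_sum fun k (_ : k ∈ Finset.univ) => hterm j k).const_mul (1 / 2)).const_sub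
      (2 * Real.pi)
  refine h.congr_deriv ?_
  simp only [Finset.sum_add_distrib]
  -- Exchanging `j` and `k` identifies the two sums, which cancels the factor `1 / 2` for ordered
  -- pairs.
  rw [Finset.sum_comm (f := fun j k => (if ({i, k, j} : Finset V) ∈ T.faces then
    innerAngleWeight Φ r i k j else 0) * (v k - v i))]
  simp only [← Finset.sum_mul, edgeConductance]
  rw [← two_mul, ← mul_assoc, one_div, inv_mul_cancel₀ two_ne_zero, one_mul,
    ← Finset.sum_neg_distrib]
  exact Finset.sum_congr rfl fun j _ => by ring

lemma contDiff_angleDeficit (hΦ : T.IsWeight Φ) {n : WithTop ℕ∞} (i : V) :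
    ContDiff ℝ n fun u : V → ℝ => T.angleDeficit Φ (metricOfLog u) i := by
  refine contDiff_const.sub (contDiff_const.mul (ContDiff.sum fun j _ => ContDiff.sum fun k _ => ?_))
  split_ifs with h
  · exact contDiff_innerAngle (hΦ.isTriangleWeight h)
  · exact contDiff_const

lemma angleDeficit_mul {r : V → ℝ} {c : ℝ} (hc : 0 < c) (i : V) :
    T.angleDeficit Φ (fun i => c * r i) i = T.angleDeficit Φ r i := by
  simp only [angleDeficit, innerAngle_mul hc]

lemma angleDeficitDeriv_eq (hΦ : T.IsWeight Φ) {r : V → ℝ} (hr : IsCirclePackingMetric r)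
    {i j : V} (hij : i ≠ j) : T.angleDeficitDeriv Φ r i j = -T.edgeConductance Φ r i j := by
  set u : V → ℝ := fun k => Real.log (r k ^ 2) with hu
  have hd (k : V) : HasDerivAt (fun s => Function.update u j s k) (if k = j then 1 else 0) (u j) := by
    split_ifs with h
    · subst h
      simpa using hasDerivAt_id' (u k)
    · simpa [h] using hasDerivAt_const (u j) (u k)
  have h := (hasDerivAt_angleDeficit hΦ hd i).deriv
  refine h.trans ?_
  rw [Function.update_eq_self, hu, metricOfLog_log hr, Finset.sum_eq_single j]
  · simp [hij]
  · intro k _ hk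
    simp [hk, hij]
  · simp

lemma laplacian_apply (hΦ : T.IsWeight Φ) {r : V → ℝ} (hr : IsCirclePackingMetric r)
    (f : V → ℝ) (i : V) : T.laplacian Φ r f i =
      (1 / r i ^ 2) * ∑ j, T.edgeConductance Φ r i j * (f j - f i) := by
  classical
  change (1 / r i ^ 2) * _ = _
  congr 1
  rw [Finset.sum_filter]
  refine Finset.sum_congr rfl fun j _ => ?_
  split_ifs with h
  · rw [angleDeficitDeriv_eq hΦ hr h.ne, neg_neg]
  · rw [edgeConductance_eq_zero r h, zero_mul]

end TriangulatedSurface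

/-! ### Differential inequalities and global solutions on a half line. -/

section ode

lemma antitoneOn_Ici_of_hasDerivWithinAt {f f' : ℝ → ℝ}
    (hf : ∀ t, 0 ≤ t → HasDerivWithinAt f (f' t) (Set.Ici 0) t) (hf' : ∀ t, 0 ≤ t → f' t ≤ 0) :
    AntitoneOn f (Set.Ici 0) :=
  antitoneOn_of_hasDerivWithinAt_nonpos (convex_Ici 0)
    (fun t ht => (hf t ht).continuousWithinAt)
    (fun t ht => (hf t (interior_subset ht)).mono interior_subset)
    fun t ht => hf' t (interior_subset ht)

lemma eq_initial_of_hasDerivWithinAt_zero {f : ℝ → ℝ}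
    (hf : ∀ t, 0 ≤ t → HasDerivWithinAt f 0 (Set.Ici 0) t) {t : ℝ} (ht : 0 ≤ t) : f t = f 0 :=
  le_antisymm
    (antitoneOn_Ici_of_hasDerivWithinAt hf (fun _ _ => le_rfl) Set.self_mem_Ici ht ht)
    (neg_le_neg_iff.1 (antitoneOn_Ici_of_hasDerivWithinAt (f := fun s => -f s)
      (f' := fun _ => 0) (fun s hs => by simpa using (hf s hs).fun_neg) (fun _ _ => le_rfl)
      Set.self_mem_Ici ht ht))

lemma le_mul_exp_of_hasDerivWithinAt {f f' : ℝ → ℝ} {a : ℝ}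
    (hf : ∀ t, 0 ≤ t → HasDerivWithinAt f (f' t) (Set.Ici 0) t)
    (hf' : ∀ t, 0 ≤ t → f' t ≤ -a * f t) {t : ℝ} (ht : 0 ≤ t) :
    f t ≤ f 0 * Real.exp (-a * t) := by
  have hexp (t : ℝ) : HasDerivAt (fun t => Real.exp (a * t)) (Real.exp (a * t) * a) t := by
    simpa using ((hasDerivAt_id' t).const_mul a).exp
  have h := antitoneOn_Ici_of_hasDerivWithinAt
    (fun t ht => (hf t ht).mul (hexp t).hasDerivWithinAt) (fun t ht => by
      have := mul_le_mul_of_nonneg_right (hf' t ht) (Real.exp_pos (a * t)).le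
      linarith) Set.self_mem_Ici ht ht
  simp only [Pi.mul_apply, mul_zero, Real.exp_zero, mul_one] at h
  rw [neg_mul, Real.exp_neg, ← div_eq_mul_inv, le_div_iff₀ (Real.exp_pos _)]
  exact h

/-- If a function on a half line converges together with its derivative, the limit of the
derivative is zero. -/
lemma eq_zero_of_tendsto_of_hasDerivWithinAt {f f' : ℝ → ℝ} {L c : ℝ}
    (hf : ∀ t, 0 ≤ t → HasDerivWithinAt f (f' t) (Set.Ici 0) t) (hL : Tendsto f atTop (𝓝 L))
    (hc : Tendsto f' atTop (𝓝 c)) : c = 0 := by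
  -- Mean value theorem on `[t, t + 1]`: the increments tend to `L - L = 0`, and they are values of
  -- `f'` at points going to infinity.
  have hmv (t : ℝ) : ∃ s, t < s ∧ (0 ≤ t → f (t + 1) - f t = f' s) := by
    by_cases ht : 0 ≤ t
    · obtain ⟨s, hs, h⟩ := exists_hasDerivAt_eq_slope f f' (lt_add_one t)
        (fun s hs => ((hf s (ht.trans hs.1)).continuousWithinAt).mono
          fun x hx => ht.trans hx.1)
        (fun s hs => (hf s (ht.trans hs.1.le)).hasDerivAt (Ici_mem_nhds (ht.trans_lt hs.1)))
      exact ⟨s, hs.1, fun _ => by rw [h]; simp⟩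
    · exact ⟨t + 1, lt_add_one t, fun h => absurd h ht⟩
  choose σ hσ hσ' using hmv
  have h1 : Tendsto (fun t => f' (σ t)) atTop (𝓝 c) :=
    hc.comp (tendsto_atTop_mono (fun t => (hσ t).le) tendsto_id)
  have h2 : Tendsto (fun t => f (t + 1) - f t) atTop (𝓝 (L - L)) :=
    (hL.comp (tendsto_atTop_add_const_right _ 1 tendsto_id)).sub hL
  rw [sub_self] at h2
  refine tendsto_nhds_unique h1 (h2.congr' ?_)
  filter_upwards [eventually_ge_atTop 0] with t ht using hσ' t ht

variable {E : Type*} [NormedAddCommGroup E] [NormedSpace ℝ E] [CompleteSpace E]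

open scoped NNReal in
lemma exists_solution_Icc_of_lipschitz_of_bounded {Y : E → E} {K L : ℝ≥0}
    (hK : LipschitzWith K Y) (hL : ∀ x, ‖Y x‖ ≤ L) (x₀ : E) (n : ℝ≥0) :
    ∃ α : ℝ → E, α 0 = x₀ ∧
      ∀ t ∈ Set.Icc (0 : ℝ) n, HasDerivWithinAt α (Y (α t)) (Set.Icc 0 n) t :=
  -- With speed at most `L`, a solution stays in the ball of radius `L * n` up to time `n`.
  (IsPicardLindelof.of_time_independent (t₀ := ⟨0, le_rfl, n.2⟩) (x₀ := x₀) (a := L * n) (r := 0)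
    (L := L) (fun x _ => hL x) hK.lipschitzOnWith
    (by simp)).exists_eq_forall_mem_Icc_hasDerivWithinAt₀

/-- A bounded Lipschitz vector field has solutions for all positive times. -/
lemma exists_solution_Ici_of_lipschitz_of_bounded {Y : E → E} {K L : NNReal}
    (hK : LipschitzWith K Y) (hL : ∀ x, ‖Y x‖ ≤ L) (x₀ : E) :
    ∃ u : ℝ → E, u 0 = x₀ ∧ ∀ t, 0 ≤ t → HasDerivWithinAt u (Y (u t)) (Set.Ici 0) t := by
  choose α hα0 hα using exists_solution_Icc_of_lipschitz_of_bounded hK hL x₀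
  have hright (n : NNReal) (t : ℝ) (ht : t ∈ Set.Ico (0 : ℝ) n) :
      HasDerivWithinAt (α n) (Y (α n t)) (Set.Ici 0) t :=
    (hα n t ⟨ht.1, ht.2.le⟩).mono_of_mem_nhdsWithin <| by
      rw [← Set.Ici_inter_Iic]
      exact inter_mem_nhdsWithin _ (Iic_mem_nhds ht.2)
  have hagree (n m : NNReal) (hnm : n ≤ m) : Set.EqOn (α n) (α m) (Set.Icc 0 n) := by
    have hnm' : (n : ℝ) ≤ m := hnm
    refine ODE_solution_unique_of_mem_Icc_right (v := fun _ => Y) (s := fun _ => Set.univ)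
      (fun _ _ => hK.lipschitzOnWith)
      (fun t ht => (hα n t ht).continuousWithinAt)
      (fun t ht => (hright n t ht).mono (Set.Ici_subset_Ici.2 ht.1)) (fun _ _ => Set.mem_univ _)
      (fun t ht => ((hα m t ⟨ht.1, ht.2.trans hnm'⟩).continuousWithinAt).mono
        (Set.Icc_subset_Icc_right hnm'))
      (fun t ht => (hright m t ⟨ht.1, ht.2.trans_le hnm'⟩).mono (Set.Ici_subset_Ici.2 ht.1))
      (fun _ _ => Set.mem_univ _) (by rw [hα0, hα0])
  -- The glued curve is differentiated at `t` through the solution on `[0, t + 1]`, which covers a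
  -- neighbourhood of `t` in the half line.
  refine ⟨fun t => α t.toNNReal t, by simp [hα0], fun t ht => ?_⟩
  have heq (s : ℝ) (h0 : 0 ≤ s) (hs : s ≤ t + 1) : α s.toNNReal s = α (t + 1).toNNReal s :=
    hagree _ _ (Real.toNNReal_le_toNNReal hs) ⟨h0, by rw [Real.coe_toNNReal s h0]⟩
  have hd := hright (t + 1).toNNReal t ⟨ht, by
    rw [Real.coe_toNNReal _ (by linarith)]; exact lt_add_one t⟩
  rw [← heq t ht (by linarith)] at hd
  refine hd.congr_of_eventuallyEq ?_ (heq t ht (by linarith))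
  filter_upwards [self_mem_nhdsWithin, mem_nhdsWithin_of_mem_nhds (Iic_mem_nhds (lt_add_one t))]
    with s hs hs' using heq s hs hs'

end ode

/-! ### The bilinear form and the cone of differences of metrics of equal area. -/

section pairing

variable {V : Type*} [Fintype V]

/-- The standard bilinear form on functions on a finite set. -/
def pairing : (V → ℝ) →L[ℝ] (V → ℝ) →L[ℝ] ℝ :=
  ∑ i, (ContinuousLinearMap.proj (R := ℝ) (φ := fun _ : V => ℝ) i).smulRight
    (ContinuousLinearMap.proj (R := ℝ) (φ := fun _ : V => ℝ) i)

lemma pairing_apply (x y : V → ℝ) : pairing x y = ∑ i, x i * y i := by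
  simp [pairing]

/-- The functions that are neither positive nor negative throughout. -/
def mixedSignCone (V : Type*) : Set (V → ℝ) := {x | (∃ i, x i ≤ 0) ∧ ∃ i, 0 ≤ x i}

lemma isClosed_mixedSignCone : IsClosed (mixedSignCone V) := by
  have h : mixedSignCone V = (⋃ i, {x | x i ≤ 0}) ∩ ⋃ i, {x | 0 ≤ x i} := by
    ext x; simp [mixedSignCone]
  rw [h]
  exact (isClosed_iUnion_of_finite fun i => isClosed_le (continuous_apply i) continuous_const).inter
    (isClosed_iUnion_of_finite fun i => isClosed_le continuous_const (continuous_apply i))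

omit [Fintype V] in
lemma smul_mem_mixedSignCone {x : V → ℝ} (hx : x ∈ mixedSignCone V) {c : ℝ} (hc : 0 ≤ c) :
    c • x ∈ mixedSignCone V := by
  obtain ⟨⟨i, hi⟩, j, hj⟩ := hx
  exact ⟨⟨i, mul_nonpos_of_nonneg_of_nonpos hc hi⟩, j, mul_nonneg hc hj⟩

omit [Fintype V] in
lemma eq_zero_of_mem_mixedSignCone {x : V → ℝ} (hx : x ∈ mixedSignCone V) {c : ℝ}
    (hc : ∀ i, x i = c) : x = 0 := by
  obtain ⟨⟨i, hi⟩, j, hj⟩ := hx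
  rw [hc] at hi hj
  funext k
  rw [hc k, le_antisymm hi hj, Pi.zero_apply]

/-- The level sets of the area are curved, so no linear complement of the constants contains the
differences of their points. This cone does, and it meets the constants only in 0. -/
lemma sub_mem_mixedSignCone [Nonempty V] {u v : V → ℝ}
    (h : ∑ i, Real.exp (u i) = ∑ i, Real.exp (v i)) : u - v ∈ mixedSignCone V := by
  constructor
  · by_contra! hn
    exact h.not_gt (Finset.sum_lt_sum_of_nonempty Finset.univ_nonempty fun i _ =>
      Real.exp_lt_exp.2 (by simpa using hn i))
  · by_contra! hn
    exact h.not_lt (Finset.sum_lt_sum_of_nonempty Finset.univ_nonempty fun i _ =>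
      Real.exp_lt_exp.2 (by simpa using hn i))

end pairing

/-! ### Convex gradient fields: potential, coercivity, properness. -/

/-- A vector field that is the gradient of a function which is convex, and strictly so in all
directions but the constant one, in which it does not change. -/
structure IsConvexGradientField {V : Type*} [Fintype V] (G : (V → ℝ) → V → ℝ) : Prop where
  contDiff : ContDiff ℝ 1 G
  symm : ∀ u x y, pairing (fderiv ℝ G u x) y = pairing (fderiv ℝ G u y) x
  pos : ∀ u x, (¬ ∃ c, ∀ i, x i = c) → 0 < pairing (fderiv ℝ G u x) x
  sum_eq_zero : ∀ u, ∑ i, G u i = 0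

namespace IsConvexGradientField

variable {V : Type*} [Fintype V] {G : (V → ℝ) → V → ℝ} (hG : IsConvexGradientField G)
include hG

lemma hasFDerivAt (u : V → ℝ) : HasFDerivAt G (fderiv ℝ G u) u :=
  (hG.contDiff.differentiable one_ne_zero u).hasFDerivAt

/-- By symmetry of the Jacobian the 1-form `pairing (G u)` is closed, hence exact on the convex
domain. -/
lemma exists_potential : ∃ F : (V → ℝ) → ℝ, ∀ u, HasFDerivAt F (pairing (G u)) u := by
  have hd (u : V → ℝ) : HasFDerivAt (fun u => pairing (G u)) (pairing.comp (fderiv ℝ G u)) u :=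
    pairing.hasFDerivAt.comp u (hG.hasFDerivAt u)
  obtain ⟨F, hF⟩ := convex_univ.exists_forall_hasFDerivAt_of_fderiv_symmetric isOpen_univ
    (fun u _ => (hd u).differentiableAt.differentiableWithinAt)
    (fun u _ x y => by rw [(hd u).fderiv]; exact hG.symm u x y)
  exact ⟨F, fun u => hF u (Set.mem_univ u)⟩

lemma hasDerivAt_line (u x : V → ℝ) (s : ℝ) :
    HasDerivAt (fun s : ℝ => pairing (G (u + s • x)) x)
      (pairing (fderiv ℝ G (u + s • x) x) x) s := by
  have h1 : HasDerivAt (fun s : ℝ => u + s • x) x s := by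
    simpa using ((hasDerivAt_id' s).smul_const x).const_add u
  exact (pairing.flip x).hasFDerivAt.comp_hasDerivAt s
    ((hG.hasFDerivAt (u + s • x)).comp_hasDerivAt s h1)

lemma pairing_fderiv_nonneg (u : V → ℝ) {x : V → ℝ} (hx : x ∈ mixedSignCone V) :
    0 ≤ pairing (fderiv ℝ G u x) x := by
  by_cases h : ∃ c, ∀ i, x i = c
  · obtain ⟨c, hc⟩ := h
    simp [eq_zero_of_mem_mixedSignCone hx hc]
  · exact (hG.pos u x h).le

lemma monotone_line (u : V → ℝ) {x : V → ℝ} (hx : x ∈ mixedSignCone V) :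
    Monotone fun s : ℝ => pairing (G (u + s • x)) x :=
  monotone_of_hasDerivAt_nonneg (fun s => hG.hasDerivAt_line u x s)
    fun _ => hG.pairing_fderiv_nonneg _ hx

/-- Compactness of the ball times the unit sphere of the cone, on which the form is positive; then
homogeneity in `x`. -/
lemma exists_coercive (u₀ : V → ℝ) (R : ℝ) : ∃ c, 0 < c ∧ ∀ u x, ‖u - u₀‖ ≤ R →
    x ∈ mixedSignCone V → c * ‖x‖ ^ 2 ≤ pairing (fderiv ℝ G u x) x := by
  set S : Set ((V → ℝ) × (V → ℝ)) :=
    Metric.closedBall u₀ R ×ˢ (Metric.sphere 0 1 ∩ mixedSignCone V) with hS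
  have hcomp : IsCompact S :=
    (isCompact_closedBall _ _).prod ((isCompact_sphere _ _).inter_right isClosed_mixedSignCone)
  have hcont : Continuous fun p : (V → ℝ) × (V → ℝ) => pairing (fderiv ℝ G p.1 p.2) p.2 := by
    have := hG.contDiff.continuous_fderiv one_ne_zero
    fun_prop
  have hpos (p) (hp : p ∈ S) : 0 < pairing (fderiv ℝ G p.1 p.2) p.2 := by
    refine hG.pos _ _ fun ⟨c, hc⟩ => ?_
    have h0 := eq_zero_of_mem_mixedSignCone hp.2.2 hc
    have h1 : ‖p.2‖ = 1 := by simpa using hp.2.1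
    rw [h0, norm_zero] at h1
    exact zero_ne_one h1
  obtain ⟨c, hc, hle⟩ : ∃ c, 0 < c ∧ ∀ p ∈ S, c ≤ pairing (fderiv ℝ G p.1 p.2) p.2 := by
    rcases S.eq_empty_or_nonempty with h | h
    · exact ⟨1, one_pos, by simp [h]⟩
    · obtain ⟨p, hp, hmin⟩ := hcomp.exists_isMinOn h hcont.continuousOn
      exact ⟨_, hpos p hp, fun q hq => hmin hq⟩
  refine ⟨c, hc, fun u x hu hx => ?_⟩
  rcases eq_or_ne x 0 with rfl | hx0
  · simp
  have hn : 0 < ‖x‖ := norm_pos_iff.2 hx0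
  have h := hle (u, ‖x‖⁻¹ • x) ⟨by simpa [dist_eq_norm] using hu,
    by simp [norm_smul, hn.ne'], smul_mem_mixedSignCone hx (by positivity)⟩
  simp only [map_smul, _root_.smul_apply, smul_eq_mul] at h
  have := mul_le_mul_of_nonneg_right h (sq_nonneg ‖x‖)
  refine this.trans_eq ?_
  field_simp

variable {F : (V → ℝ) → ℝ} (hF : ∀ u, HasFDerivAt F (pairing (G u)) u)
  {u₀ : V → ℝ} (h₀ : G u₀ = 0)

omit hG in
include hF in
lemma hasDerivAt_potential_line (u x : V → ℝ) (s : ℝ) :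
    HasDerivAt (fun s : ℝ => F (u + s • x)) (pairing (G (u + s • x)) x) s := by
  have h1 : HasDerivAt (fun s : ℝ => u + s • x) x s := by
    simpa using ((hasDerivAt_id' s).smul_const x).const_add u
  exact (hF (u + s • x)).comp_hasDerivAt s h1

include hF in
lemma potential_sub_le {x : V → ℝ} (hx : x ∈ mixedSignCone V) :
    F (u₀ + x) - F u₀ ≤ pairing (G (u₀ + x)) x := by
  obtain ⟨s, hs, h⟩ := exists_hasDerivAt_eq_slope (fun s : ℝ => F (u₀ + s • x))
    (fun s => pairing (G (u₀ + s • x)) x) one_pos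
    (fun s _ => (hasDerivAt_potential_line hF u₀ x s).continuousAt.continuousWithinAt)
    (fun s _ => hasDerivAt_potential_line hF u₀ x s)
  have := hG.monotone_line u₀ hx hs.2.le
  simp only [one_smul, zero_smul, add_zero, sub_zero, div_one] at h this
  linarith

lemma convexOn_potential_line (hF : ∀ u, HasFDerivAt F (pairing (G u)) u) {x : V → ℝ}
    (hx : x ∈ mixedSignCone V) : ConvexOn ℝ Set.univ fun s : ℝ => F (u₀ + s • x) := by
  refine Monotone.convexOn_univ_of_deriv
    (fun s => (hasDerivAt_potential_line hF u₀ x s).differentiableAt) ?_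
  rw [show deriv (fun s : ℝ => F (u₀ + s • x)) = fun s => pairing (G (u₀ + s • x)) x from
    funext fun s => (hasDerivAt_potential_line hF u₀ x s).deriv]
  exact hG.monotone_line u₀ hx

-- The coercivity bound integrated along the segment from the zero `u₀` of `G`; a second integration
-- gives `le_potential_sub`.
include h₀ in
lemma le_pairing_line {R c : ℝ} (hc : ∀ u x, ‖u - u₀‖ ≤ R → x ∈ mixedSignCone V →
      c * ‖x‖ ^ 2 ≤ pairing (fderiv ℝ G u x) x)
    {x : V → ℝ} (hx : x ∈ mixedSignCone V) (hxR : ‖x‖ ≤ R) {s : ℝ} (hs : s ∈ Set.Icc (0 : ℝ) 1) :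
    c * ‖x‖ ^ 2 * s ≤ pairing (G (u₀ + s • x)) x := by
  have hd (s : ℝ) : HasDerivAt (fun s : ℝ => pairing (G (u₀ + s • x)) x - c * ‖x‖ ^ 2 * s)
      (pairing (fderiv ℝ G (u₀ + s • x) x) x - c * ‖x‖ ^ 2) s := by
    simpa using (hG.hasDerivAt_line u₀ x s).fun_sub ((hasDerivAt_id' s).const_mul (c * ‖x‖ ^ 2))
  have hmono := monotoneOn_of_hasDerivWithinAt_nonneg (convex_Icc (0 : ℝ) 1)
    (fun s _ => (hd s).continuousAt.continuousWithinAt) (fun s _ => (hd s).hasDerivWithinAt)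
    (fun _ hs => sub_nonneg.2 (hc _ x (by
      have hs' := interior_subset hs
      rw [add_sub_cancel_left, norm_smul, Real.norm_of_nonneg hs'.1]
      exact (mul_le_of_le_one_left (norm_nonneg _) hs'.2).trans hxR) hx))
    (Set.left_mem_Icc.2 zero_le_one) hs hs.1
  simp only [zero_smul, add_zero, h₀, map_zero, _root_.zero_apply, mul_zero,
    sub_zero] at hmono
  linarith

include hF h₀ in
lemma le_potential_sub {R c : ℝ} (hc : ∀ u x, ‖u - u₀‖ ≤ R → x ∈ mixedSignCone V →
      c * ‖x‖ ^ 2 ≤ pairing (fderiv ℝ G u x) x)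
    {x : V → ℝ} (hx : x ∈ mixedSignCone V) (hxR : ‖x‖ ≤ R) :
    c / 2 * ‖x‖ ^ 2 ≤ F (u₀ + x) - F u₀ := by
  have hd (s : ℝ) : HasDerivAt (fun s : ℝ => F (u₀ + s • x) - c / 2 * ‖x‖ ^ 2 * s ^ 2)
      (pairing (G (u₀ + s • x)) x - c * ‖x‖ ^ 2 * s) s :=
    ((hasDerivAt_potential_line hF u₀ x s).fun_sub
      ((hasDerivAt_pow 2 s).const_mul (c / 2 * ‖x‖ ^ 2))).congr_deriv (by push_cast; ring)
  have hmono := monotoneOn_of_hasDerivWithinAt_nonneg (convex_Icc (0 : ℝ) 1)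
    (fun s _ => (hd s).continuousAt.continuousWithinAt) (fun s _ => (hd s).hasDerivWithinAt)
    (fun s hs => sub_nonneg.2 (hG.le_pairing_line h₀ hc hx hxR (interior_subset hs)))
    (Set.left_mem_Icc.2 zero_le_one) (Set.right_mem_Icc.2 zero_le_one) zero_le_one
  simp only [zero_smul, add_zero, one_smul] at hmono
  linarith

-- On the unit sphere of the cone `F - F u₀` is at least `c / 2`. Convexity along rays turns this
-- into growth of slope `c / 2` outside the unit ball, which explains the radius chosen.
include hF h₀ in
lemma exists_norm_le_of_potential_le (M : ℝ) :
    ∃ R, ∀ x ∈ mixedSignCone V, F (u₀ + x) ≤ M → ‖x‖ ≤ R := by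
  obtain ⟨c, hc0, hc⟩ := hG.exists_coercive u₀ 1
  refine ⟨max 1 ((M - F u₀) / (c / 2)), fun x hx hM => ?_⟩
  by_contra! hlt
  obtain ⟨h1, h2⟩ := max_lt_iff.1 hlt
  have hn : 0 < ‖x‖ := one_pos.trans h1
  rw [div_lt_iff₀ (by positivity)] at h2
  set y := ‖x‖⁻¹ • x
  have hy : y ∈ mixedSignCone V := smul_mem_mixedSignCone hx (by positivity)
  have hy1 : ‖y‖ = 1 := by simp [y, norm_smul, hn.ne']
  have h3 := hG.le_potential_sub hF h₀ hc hy hy1.le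
  -- Convexity at the parameter `1`, between the parameters `0` and `‖x‖` on the ray through `y`.
  have h4 := (hG.convexOn_potential_line (u₀ := u₀) hF hy).2 (Set.mem_univ 0)
    (Set.mem_univ ‖x‖) 
    (sub_nonneg.2 (inv_le_one_of_one_le₀ h1.le) : 0 ≤ 1 - ‖x‖⁻¹)
    (by positivity : 0 ≤ ‖x‖⁻¹) (by ring)
  have h5 : ‖x‖ • y = x := by simp [y, smul_smul, hn.ne']
  simp only [smul_eq_mul, mul_zero, zero_add, inv_mul_cancel₀ hn.ne', one_smul, zero_smul,
    add_zero, h5] at h4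
  rw [hy1] at h3
  have h6 : c / 2 ≤ ‖x‖⁻¹ * (F (u₀ + x) - F u₀) := by linarith
  have h7 := mul_le_mul_of_nonneg_left h6 hn.le
  rw [← mul_assoc, mul_inv_cancel₀ hn.ne', one_mul] at h7
  linarith

end IsConvexGradientField

/-! ### The descent flow: conservation, existence, exponential decay. -/

/-- The downward gradient flow of `G` with respect to the metric with weights `exp (u i)`. -/
def weightedDescentField {V : Type*} (G : (V → ℝ) → V → ℝ) (u : V → ℝ) : V → ℝ :=
  fun i => -(Real.exp (-u i) * G u i)

section flow

variable {V : Type*} [Fintype V] {G : (V → ℝ) → V → ℝ} {F : (V → ℝ) → ℝ}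
  {u : ℝ → V → ℝ} {a : ℝ → ℝ}

lemma pairing_weightedDescentField (u : V → ℝ) :
    pairing (G u) (weightedDescentField G u) = -∑ i, Real.exp (-u i) * G u i ^ 2 := by
  rw [pairing_apply, ← Finset.sum_neg_distrib]
  exact Finset.sum_congr rfl fun i _ => by rw [weightedDescentField]; ring

/-- The weights cancel in the derivative, leaving `-a t * ∑ i, G (u t) i = 0`. The factor `a` covers
the flow damped by a cutoff too. -/
lemma sum_exp_eq_of_flow (hG : IsConvexGradientField G)
    (hu : ∀ t, 0 ≤ t → HasDerivWithinAt u (a t • weightedDescentField G (u t)) (Set.Ici 0) t)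
    {t : ℝ} (ht : 0 ≤ t) : ∑ i, Real.exp (u t i) = ∑ i, Real.exp (u 0 i) := by
  refine eq_initial_of_hasDerivWithinAt_zero (f := fun t => ∑ i, Real.exp (u t i))
    (fun t ht => ?_) ht
  have h := HasDerivWithinAt.fun_sum fun i (_ : i ∈ Finset.univ) =>
    (hasDerivWithinAt_pi.1 (hu t ht) i).exp
  refine h.congr_deriv ?_
  have : ∀ i, Real.exp (u t i) * (a t • weightedDescentField G (u t)) i = -a t * G (u t) i := by
    intro i
    have : Real.exp (u t i) * Real.exp (-u t i) = 1 := by rw [← Real.exp_add]; simp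
    simp only [weightedDescentField, Pi.smul_apply, smul_eq_mul]
    linear_combination (-a t * G (u t) i) * this
  simp only [this, ← Finset.mul_sum, hG.sum_eq_zero, mul_zero]

lemma hasDerivWithinAt_potential (hF : ∀ u, HasFDerivAt F (pairing (G u)) u)
    (hu : ∀ t, 0 ≤ t → HasDerivWithinAt u (a t • weightedDescentField G (u t)) (Set.Ici 0) t)
    {t : ℝ} (ht : 0 ≤ t) : HasDerivWithinAt (fun t => F (u t))
      (-(a t * ∑ i, Real.exp (-u t i) * G (u t) i ^ 2)) (Set.Ici 0) t := by
  refine ((hF (u t)).comp_hasDerivWithinAt t (hu t ht)).congr_deriv ?_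
  rw [map_smul, pairing_weightedDescentField, smul_eq_mul, mul_neg]

lemma potential_le_of_flow (hF : ∀ u, HasFDerivAt F (pairing (G u)) u)
    (ha : ∀ t, 0 ≤ a t)
    (hu : ∀ t, 0 ≤ t → HasDerivWithinAt u (a t • weightedDescentField G (u t)) (Set.Ici 0) t)
    {t : ℝ} (ht : 0 ≤ t) : F (u t) ≤ F (u 0) :=
  antitoneOn_Ici_of_hasDerivWithinAt (fun _ ht => hasDerivWithinAt_potential hF hu ht)
    (fun t _ => neg_nonpos.2 (mul_nonneg (ha t) (Finset.sum_nonneg fun _ _ => by positivity)))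
    Set.self_mem_Ici ht ht

/-- A bounded solution of the descent flow converges exponentially to the zero of `G` with the
same total weight. -/
theorem IsConvexGradientField.exists_exp_decay [Nonempty V] (hG : IsConvexGradientField G)
    {u₀ : V → ℝ} (h₀ : G u₀ = 0)
    (hu : ∀ t, 0 ≤ t → HasDerivWithinAt u (weightedDescentField G (u t)) (Set.Ici 0) t)
    (hsum : ∑ i, Real.exp (u 0 i) = ∑ i, Real.exp (u₀ i)) {R : ℝ}
    (hR : ∀ t, 0 ≤ t → ‖u t - u₀‖ ≤ R) :
    ∃ C a : ℝ, 0 < C ∧ 0 < a ∧ ∀ t, 0 ≤ t → ‖u t - u₀‖ ≤ C * Real.exp (-a * t) := by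
  obtain ⟨F, hF⟩ := hG.exists_potential
  obtain ⟨c, hc0, hc⟩ := hG.exists_coercive u₀ R
  replace hu : ∀ t, 0 ≤ t →
      HasDerivWithinAt u ((1 : ℝ) • weightedDescentField G (u t)) (Set.Ici 0) t := by
    simpa using hu
  have hcone (t : ℝ) (ht : 0 ≤ t) : u t - u₀ ∈ mixedSignCone V :=
    sub_mem_mixedSignCone ((sum_exp_eq_of_flow hG hu ht).trans hsum)
  have hN : (0 : ℝ) < Fintype.card V := by exact_mod_cast Fintype.card_pos
  -- A lower bound for the weights `exp (-u t i)` along the bounded solution.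
  set m := Real.exp (-(‖u₀‖ + R)) with hm
  have hm0 : 0 < m := Real.exp_pos _
  set κ := m * (c / Fintype.card V) with hκ
  have hκ0 : 0 < κ := by positivity
  have hlow (t : ℝ) (ht : 0 ≤ t) : c / 2 * ‖u t - u₀‖ ^ 2 ≤ F (u t) - F u₀ := by
    simpa using hG.le_potential_sub hF h₀ hc (hcone t ht) (hR t ht)
  have hdecay (t : ℝ) (ht : 0 ≤ t) :
      -(1 * ∑ i, Real.exp (-u t i) * G (u t) i ^ 2) ≤ -κ * (F (u t) - F u₀) := by
    set x := u t - u₀ with hx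
    have hux : u₀ + x = u t := by simp [hx]
    have hxc : x ∈ mixedSignCone V := hcone t ht
    have hxR : ‖x‖ ≤ R := hR t ht
    have h1 : F (u t) - F u₀ ≤ pairing (G (u t)) x := by
      simpa only [hux] using hG.potential_sub_le hF (u₀ := u₀) hxc
    have h2 : c * ‖x‖ ^ 2 ≤ pairing (G (u t)) x := by
      simpa only [hux, mul_one, one_smul] using
        hG.le_pairing_line h₀ hc hxc hxR (Set.right_mem_Icc.2 zero_le_one)
    -- Cauchy–Schwarz; `‖x‖` is the sup norm, whence the factor `Fintype.card V`.
    have h3 : pairing (G (u t)) x ^ 2 ≤ (∑ i, G (u t) i ^ 2) * (Fintype.card V * ‖x‖ ^ 2) := by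
      rw [pairing_apply]
      refine (Finset.sum_mul_sq_le_sq_mul_sq _ _ _).trans
        (mul_le_mul_of_nonneg_left ?_ (Finset.sum_nonneg fun _ _ => sq_nonneg _))
      rw [← nsmul_eq_mul, Fintype.card]
      refine Finset.sum_le_card_nsmul _ _ _ fun i _ => ?_
      rw [← sq_abs]
      exact pow_le_pow_left₀ (abs_nonneg _) (norm_le_pi_norm x i) 2
    have h4 : m * ∑ i, G (u t) i ^ 2 ≤ ∑ i, Real.exp (-u t i) * G (u t) i ^ 2 := by
      rw [Finset.mul_sum]
      refine Finset.sum_le_sum fun i _ => mul_le_mul_of_nonneg_right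
        (Real.exp_le_exp.2 (neg_le_neg ?_)) (sq_nonneg _)
      calc u t i ≤ ‖u t i‖ := Real.le_norm_self _
        _ ≤ ‖u t‖ := norm_le_pi_norm _ _
        _ ≤ ‖u₀‖ + ‖x‖ := by rw [← hux]; exact norm_add_le _ _
        _ ≤ ‖u₀‖ + R := by gcongr
    -- Gradient domination: `h2` absorbs `‖x‖ ^ 2` into the pairing, and one factor of the pairing
    -- cancels.
    have h5 : c / Fintype.card V * pairing (G (u t)) x ≤ ∑ i, G (u t) i ^ 2 := by
      have h0 : 0 ≤ c * ‖x‖ ^ 2 := by positivity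
      rcases (h0.trans h2).eq_or_lt with hp | hp
      · rw [← hp, mul_zero]; exact Finset.sum_nonneg fun _ _ => sq_nonneg _
      · rw [div_mul_eq_mul_div, div_le_iff₀ hN]
        refine le_of_mul_le_mul_right ?_ hp
        have h6 : (∑ i, G (u t) i ^ 2) * Fintype.card V * (c * ‖x‖ ^ 2) ≤
            (∑ i, G (u t) i ^ 2) * Fintype.card V * pairing (G (u t)) x :=
          mul_le_mul_of_nonneg_left h2
            (mul_nonneg (Finset.sum_nonneg fun _ _ => sq_nonneg _) hN.le)
        have h7 := mul_le_mul_of_nonneg_left h3 hc0.le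
        linarith
    have h6 : κ * (F (u t) - F u₀) ≤ κ * pairing (G (u t)) x := mul_le_mul_of_nonneg_left h1 hκ0.le
    have h7 := mul_le_mul_of_nonneg_left h5 hm0.le
    rw [← mul_assoc] at h7
    linarith
  have hexp (t : ℝ) (ht : 0 ≤ t) : F (u t) - F u₀ ≤ (F (u 0) - F u₀) * Real.exp (-κ * t) :=
    le_mul_exp_of_hasDerivWithinAt
      (fun t ht => (hasDerivWithinAt_potential hF hu ht).sub_const (F u₀)) hdecay ht
  have hE0 : 0 ≤ F (u 0) - F u₀ := le_trans (by positivity) (hlow 0 le_rfl)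
  -- The rate is halved because `F - F u₀` bounds the square of the norm; the summand `1` keeps `C`
  -- positive for a stationary solution.
  refine ⟨√(2 / c * (F (u 0) - F u₀)) + 1, κ / 2, by positivity, by positivity, fun t ht => ?_⟩
  have hsq : ‖u t - u₀‖ ^ 2 ≤ (√(2 / c * (F (u 0) - F u₀)) * Real.exp (-(κ / 2) * t)) ^ 2 := by
    rw [mul_pow, Real.sq_sqrt (by positivity), ← Real.exp_nat_mul,
      show ((2 : ℕ) : ℝ) * (-(κ / 2) * t) = -κ * t by push_cast; ring]
    have := mul_le_mul_of_nonneg_left ((hlow t ht).trans (hexp t ht)) (show 0 ≤ 2 / c by positivity)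
    rw [← mul_assoc, ← mul_assoc, div_mul_div_comm, mul_comm 2 c, div_self (by positivity),
      one_mul] at this
    exact this
  refine ((pow_le_pow_iff_left₀ (norm_nonneg _) (by positivity) two_ne_zero).1 hsq).trans ?_
  gcongr
  linarith

/-- The descent flow has bounded solutions for all positive times if `G` has a zero with the same
total weight as the initial value. -/
theorem IsConvexGradientField.exists_bounded_flow [Nonempty V] (hG : IsConvexGradientField G)
    {u₀ u₁ : V → ℝ} (h₀ : G u₀ = 0)
    (hsum : ∑ i, Real.exp (u₁ i) = ∑ i, Real.exp (u₀ i)) :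
    ∃ (u : ℝ → V → ℝ) (R : ℝ), u 0 = u₁ ∧
      (∀ t, 0 ≤ t → HasDerivWithinAt u (weightedDescentField G (u t)) (Set.Ici 0) t) ∧
      ∀ t, 0 ≤ t → ‖u t - u₀‖ ≤ R := by
  obtain ⟨F, hF⟩ := hG.exists_potential
  obtain ⟨R, hR⟩ := hG.exists_norm_le_of_potential_le hF h₀ (F u₁)
  -- The cutoff makes the field bounded and Lipschitz. The damped flow still conserves the total
  -- weight and does not increase `F`, so it stays where `ψ = 1` and solves the original equation.
  let ψ : ContDiffBump u₀ := ⟨max R 0 + 1, max R 0 + 2, by positivity, by linarith⟩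
  set Y : (V → ℝ) → V → ℝ := fun u => ψ u • weightedDescentField G u with hY
  have hYd : ContDiff ℝ 1 Y := by
    refine ψ.contDiff.smul (contDiff_pi.2 fun i => ?_)
    have := contDiff_pi.1 hG.contDiff i
    unfold weightedDescentField
    fun_prop
  have hYs : HasCompactSupport Y := ψ.hasCompactSupport.smul_right
  obtain ⟨K, hK⟩ := hYd.lipschitzWith_of_hasCompactSupport hYs one_ne_zero
  obtain ⟨L, hL⟩ := hYs.exists_bound_of_continuous hYd.continuous
  obtain ⟨u, hu0, hu⟩ := exists_solution_Ici_of_lipschitz_of_bounded (L := L.toNNReal) hK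
    (fun x => (hL x).trans (Real.le_coe_toNNReal L)) u₁
  have hbound (t : ℝ) (ht : 0 ≤ t) : ‖u t - u₀‖ ≤ R := by
    refine hR _ (sub_mem_mixedSignCone ((sum_exp_eq_of_flow hG hu ht).trans ?_)) ?_
    · rw [hu0, hsum]
    · rw [add_sub_cancel, ← hu0]
      exact potential_le_of_flow hF (fun _ => ψ.nonneg) hu ht
  refine ⟨u, R, hu0, fun t ht => ?_, hbound⟩
  have h1 : ψ (u t) = 1 := ψ.one_of_mem_closedBall (by
    rw [mem_closedBall_iff_norm]
    exact (hbound t ht).trans ((le_max_left R 0).trans (le_add_of_nonneg_right zero_le_one)))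
  have h2 := hu t ht
  simp only [hY] at h2
  rwa [h1, one_smul] at h2

end flow

/-! ### Spectral gap and Poincaré inequality on a weighted graph. -/

section spectral

variable {V : Type*} [Fintype V]

/-- Discrete Green formula: average the sum with its copy under the exchange of `i` and `j`. -/
lemma sum_conductance_mul {W : V → V → ℝ} (hW : ∀ i j, W i j = W j i) (f h : V → ℝ) :
    ∑ i, (∑ j, W i j * (f i - f j)) * h i =
      1 / 2 * ∑ i, ∑ j, W i j * ((f i - f j) * (h i - h j)) := by
  have h1 : ∑ i, (∑ j, W i j * (f i - f j)) * h i = ∑ i, ∑ j, W i j * ((f i - f j) * h i) := by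
    simp only [Finset.sum_mul, mul_assoc]
  have h2 : ∑ i, ∑ j, W i j * ((f i - f j) * h i) = ∑ i, ∑ j, W i j * ((f j - f i) * h j) := by
    rw [Finset.sum_comm]
    simp only [hW]
  have h3 : ∑ i, ∑ j, W i j * ((f i - f j) * (h i - h j)) =
      ∑ i, ∑ j, W i j * ((f i - f j) * h i) + ∑ i, ∑ j, W i j * ((f j - f i) * h j) := by
    simp only [← Finset.sum_add_distrib]
    exact Finset.sum_congr rfl fun i _ => Finset.sum_congr rfl fun j _ => by ring
  rw [h3, ← h2, h1]
  ring

/-- Functions on a finite set as a Euclidean space with weights `m`. -/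
def weightedEuclidean (m : V → ℝ) (hm : ∀ i, 0 < m i) : EuclideanSpace ℝ V ≃ₗ[ℝ] (V → ℝ) :=
  (WithLp.linearEquiv 2 ℝ (V → ℝ)).trans (LinearEquiv.piCongrRight fun i =>
    LinearEquiv.smulOfNeZero ℝ ℝ (√(m i))⁻¹ (inv_ne_zero (Real.sqrt_pos.2 (hm i)).ne'))

omit [Fintype V] in
lemma weightedEuclidean_apply (m : V → ℝ) (hm : ∀ i, 0 < m i) (g : EuclideanSpace ℝ V) (i : V) :
    weightedEuclidean m hm g i = (√(m i))⁻¹ * g i := rfl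

lemma inner_eq_weighted_sum (m : V → ℝ) (hm : ∀ i, 0 < m i) (g h : EuclideanSpace ℝ V) :
    inner ℝ g h = ∑ i, m i * (weightedEuclidean m hm g i * weightedEuclidean m hm h i) := by
  rw [PiLp.inner_apply]
  refine Finset.sum_congr rfl fun i _ => ?_
  have h1 := Real.sqrt_pos.2 (hm i)
  have h2 := Real.sq_sqrt (hm i).le
  rw [weightedEuclidean_apply, weightedEuclidean_apply]
  simp only [RCLike.inner_apply, conj_trivial]
  field_simp
  rw [h2]

/-- **Poincaré inequality**: the Dirichlet energy of a nonconstant function of mean zero exceeds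
`ρ` times its squared norm if all positive eigenvalues of the negative Laplacian exceed `ρ`. -/
theorem dirichlet_gt_of_eigenvalues_gt {W : V → V → ℝ} (hW : ∀ i j, W i j = W j i)
    (hW0 : ∀ i j, 0 ≤ W i j) (hconn : ∀ f : V → ℝ, (∀ i j, 0 < W i j → f i = f j) →
      ∀ i j, f i = f j)
    {m : V → ℝ} (hm : ∀ i, 0 < m i) {D : (V → ℝ) →ₗ[ℝ] (V → ℝ)}
    (hD : ∀ f i, m i * D f i = ∑ j, W i j * (f j - f i)) {ρ : ℝ}
    (hρ : ∀ μ, 0 < μ → Module.End.HasEigenvalue (-D) μ → ρ < μ)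
    {x : V → ℝ} (hx : x ≠ 0) (hmean : ∑ i, m i * x i = 0) :
    ρ * ∑ i, m i * x i ^ 2 < ∑ i, (∑ j, W i j * (x i - x j)) * x i := by
  set φ := weightedEuclidean m hm
  -- `-D` is symmetric for the weights `m`; conjugated to the standard Euclidean space it admits an
  -- orthonormal eigenbasis.
  set A : EuclideanSpace ℝ V →ₗ[ℝ] EuclideanSpace ℝ V :=
    φ.symm.toLinearMap ∘ₗ (-D) ∘ₗ φ.toLinearMap with hA
  have hφA (g : EuclideanSpace ℝ V) : φ (A g) = -D (φ g) := by simp [hA]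
  have hinner (g h : EuclideanSpace ℝ V) :
      inner ℝ (A g) h = ∑ i, (∑ j, W i j * (φ g i - φ g j)) * φ h i := by
    rw [inner_eq_weighted_sum m hm, hφA]
    refine Finset.sum_congr rfl fun i _ => ?_
    rw [← mul_assoc, Pi.neg_apply, mul_neg, hD, ← Finset.sum_neg_distrib]
    congr 1
    exact Finset.sum_congr rfl fun j _ => by ring
  have hsymm : A.IsSymmetric := by
    intro g h
    rw [real_inner_comm (A h) g, hinner, hinner, sum_conductance_mul hW, sum_conductance_mul hW]
    congr 1
    exact Finset.sum_congr rfl fun i _ => Finset.sum_congr rfl fun j _ => by ring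
  set b := hsymm.eigenvectorBasis rfl with hb
  set μ := hsymm.eigenvalues rfl with hμ
  have hAb (k) : A (b k) = μ k • b k := hsymm.apply_eigenvectorBasis rfl k
  have henergy (g : EuclideanSpace ℝ V) : 0 ≤ inner ℝ (A g) g ∧
      (inner ℝ (A g) g = 0 → ∀ i j, φ g i = φ g j) := by
    have hnn (i j : V) : 0 ≤ W i j * ((φ g i - φ g j) * (φ g i - φ g j)) :=
      mul_nonneg (hW0 i j) (mul_self_nonneg _)
    rw [hinner, sum_conductance_mul hW]
    refine ⟨mul_nonneg (by norm_num) (Finset.sum_nonneg fun i _ => Finset.sum_nonneg fun j _ =>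
      hnn i j), fun h0 => hconn _ fun i j hij => ?_⟩
    have h1 := (mul_eq_zero.1 h0).resolve_left (by norm_num)
    have h2 := (Finset.sum_eq_zero_iff_of_nonneg fun i _ => Finset.sum_nonneg fun j _ =>
      hnn i j).1 h1 i (Finset.mem_univ i)
    have h3 := (Finset.sum_eq_zero_iff_of_nonneg fun j _ => hnn i j).1 h2 j (Finset.mem_univ j)
    exact sub_eq_zero.1 (mul_self_eq_zero.1 ((mul_eq_zero.1 h3).resolve_left hij.ne'))
  have hnorm (k) : inner ℝ (A (b k)) (b k) = μ k := by
    rw [hAb, real_inner_smul_left, real_inner_self_eq_norm_sq, b.orthonormal.1 k]; simp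
  set g := φ.symm x with hg
  have hφg : φ g = x := by simp [hg]
  -- Eigenvectors for the eigenvalue 0 correspond to constants, to which `x` is orthogonal by
  -- `hmean`; only positive eigenvalues contribute.
  have hk (k) (hne : inner ℝ (b k) g ≠ 0) : ρ < μ k := by
    have h0 : 0 ≤ μ k := (hnorm k) ▸ (henergy (b k)).1
    rcases h0.eq_or_lt with h0 | h0
    · refine absurd ?_ hne
      have hc := (henergy (b k)).2 ((hnorm k).trans h0.symm)
      rw [inner_eq_weighted_sum m hm, hφg]
      rcases isEmpty_or_nonempty V with hV | ⟨⟨i₀⟩⟩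
      · simp
      · rw [← mul_zero (φ (b k) i₀), ← hmean, Finset.mul_sum]
        exact Finset.sum_congr rfl fun i _ => by rw [hc i i₀]; ring
    · refine hρ _ h0 (Module.End.hasEigenvalue_of_hasEigenvector (x := φ (b k))
        (Module.End.hasEigenvector_iff.2 ⟨Module.End.mem_eigenspace_iff.2 ?_, ?_⟩))
      · rw [LinearMap.neg_apply, ← hφA, hAb, map_smul]
      · rw [Ne, φ.map_eq_zero_iff]
        exact b.orthonormal.ne_zero k
  have hnormsq : ∑ i, m i * x i ^ 2 = ∑ k, inner ℝ (b k) g ^ 2 := by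
    have h1 := inner_eq_weighted_sum m hm g g
    rw [← b.sum_inner_mul_inner] at h1
    have h2 : weightedEuclidean m hm g = x := hφg
    simp only [h2, real_inner_comm, ← sq] at h1
    simpa only [real_inner_comm] using h1.symm
  have hen : ∑ i, (∑ j, W i j * (x i - x j)) * x i = ∑ k, μ k * inner ℝ (b k) g ^ 2 := by
    have h1 := hinner g g
    rw [hφg, ← b.sum_inner_mul_inner] at h1
    rw [← h1]
    refine Finset.sum_congr rfl fun k _ => ?_
    rw [hsymm g (b k), hAb, real_inner_smul_right, real_inner_comm]
    ring
  rw [hnormsq, hen, Finset.mul_sum]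
  have hg0 : g ≠ 0 := by
    rintro h0
    exact hx (by rw [← hφg, h0, map_zero])
  obtain ⟨k, hk0⟩ : ∃ k, inner ℝ (b k) g ≠ 0 := by
    by_contra! h
    exact hg0 (by rw [← b.sum_repr' g]; simp [h])
  refine Finset.sum_lt_sum (fun k _ => ?_) ⟨k, Finset.mem_univ k, ?_⟩
  · by_cases h : inner ℝ (b k) g = 0
    · simp [h]
    · exact mul_le_mul_of_nonneg_right (hk k h).le (sq_nonneg _)
  · exact mul_lt_mul_of_pos_right (hk k hk0) (by positivity)

end spectral

/-! ### Between radii and logarithmic coordinates. -/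

lemma abs_exp_sub_exp_le {x y B : ℝ} (hx : x ≤ B) (hy : y ≤ B) :
    |Real.exp x - Real.exp y| ≤ Real.exp B * |x - y| := by
  wlog h : x ≤ y generalizing x y
  · rw [abs_sub_comm, abs_sub_comm x]
    exact this hy hx (le_of_not_ge h)
  rw [abs_sub_comm, abs_sub_comm x, abs_of_nonneg (sub_nonneg.2 (Real.exp_le_exp.2 h)),
    abs_of_nonneg (sub_nonneg.2 h)]
  have h1 := Real.add_one_le_exp (x - y)
  have h2 : Real.exp x = Real.exp y * Real.exp (x - y) := by rw [← Real.exp_add]; simp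
  calc Real.exp y - Real.exp x = Real.exp y * (1 - Real.exp (x - y)) := by rw [h2]; ring
    _ ≤ Real.exp y * (y - x) := mul_le_mul_of_nonneg_left (by linarith) (Real.exp_pos y).le
    _ ≤ Real.exp B * (y - x) :=
      mul_le_mul_of_nonneg_right (Real.exp_le_exp.2 hy) (sub_nonneg.2 h)

/-- The logarithmic coordinates of a circle packing metric. -/
def logOfMetric {V : Type*} (r : V → ℝ) : V → ℝ := fun i => Real.log (r i ^ 2)

lemma metricOfLog_logOfMetric {V : Type*} {r : V → ℝ} (hr : IsCirclePackingMetric r) :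
    metricOfLog (logOfMetric r) = r := metricOfLog_log hr

lemma exists_norm_sub_le_of_tendsto {E : Type*} [NormedAddCommGroup E] {u : ℝ → E} {x : E}
    (hu : ContinuousOn u (Set.Ici 0)) (hlim : Tendsto u atTop (𝓝 x)) :
    ∃ R, ∀ t, 0 ≤ t → ‖u t - x‖ ≤ R := by
  obtain ⟨T, hT⟩ := (Metric.tendsto_atTop.1 hlim 1 one_pos)
  obtain ⟨B, hB⟩ := isCompact_Icc.exists_bound_of_continuousOn
    ((hu.mono Set.Icc_subset_Ici_self).sub (continuousOn_const (c := x)) : ContinuousOn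
      (u - fun _ => x) (Set.Icc 0 T))
  refine ⟨max 1 B, fun t ht => ?_⟩
  rcases le_total T t with h | h
  · exact (by simpa [dist_eq_norm] using (hT t h).le : ‖u t - x‖ ≤ 1).trans (le_max_left _ _)
  · exact (hB t ⟨ht, h⟩).trans (le_max_right _ _)

/-! ### The Ricci flow as the descent flow of the curvature defect. -/

namespace TriangulatedSurface

variable {V : Type*} [Fintype V] [DecidableEq V] {T : TriangulatedSurface V} {Φ : Sym2 V → ℝ}

lemma averageCurvature_eq {r : V → ℝ} (hr : IsCirclePackingMetric r) :
    T.averageCurvature Φ r = (∑ i, T.angleDeficit Φ r i) / ∑ i, r i ^ 2 := by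
  rw [averageCurvature]
  congr 1
  exact Finset.sum_congr rfl fun i _ => div_mul_cancel₀ _ (pow_pos (hr i) 2).ne'

variable (T Φ) in
/-- The deviation of the angle deficits from those of constant curvature, in logarithmic
coordinates. -/
def curvatureDefect (u : V → ℝ) : V → ℝ := fun i =>
  T.angleDeficit Φ (metricOfLog u) i - T.averageCurvature Φ (metricOfLog u) * Real.exp (u i)

lemma nonempty (T : TriangulatedSurface V) : Nonempty V := T.connected.nonempty

lemma sum_exp_pos (T : TriangulatedSurface V) (u : V → ℝ) : 0 < ∑ i, Real.exp (u i) :=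
  haveI := T.nonempty
  Finset.sum_pos (fun _ _ => Real.exp_pos _) Finset.univ_nonempty

lemma averageCurvature_metricOfLog (u : V → ℝ) : T.averageCurvature Φ (metricOfLog u) =
    (∑ i, T.angleDeficit Φ (metricOfLog u) i) / ∑ i, Real.exp (u i) := by
  rw [averageCurvature_eq (metricOfLog_pos u)]
  simp only [metricOfLog_sq]

lemma contDiff_curvatureDefect (hΦ : T.IsWeight Φ) : ContDiff ℝ 1 (T.curvatureDefect Φ) := by
  refine contDiff_pi.2 fun i => (contDiff_angleDeficit hΦ i).sub (ContDiff.mul ?_ (by fun_prop))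
  simp only [averageCurvature_metricOfLog]
  exact (ContDiff.sum fun i _ => contDiff_angleDeficit hΦ i).div (by fun_prop)
    fun u => (T.sum_exp_pos u).ne'

/-- Infinitesimal Gauss–Bonnet: the total curvature does not vary, so `R_av` varies only through the
area. -/
lemma sum_edgeConductance_mul_eq_zero (r x : V → ℝ) :
    ∑ i, ∑ j, T.edgeConductance Φ r i j * (x i - x j) = 0 := by
  simpa using sum_conductance_mul (edgeConductance_comm (T := T) (Φ := Φ) r) x 1

lemma fderiv_curvatureDefect (hΦ : T.IsWeight Φ) (u x : V → ℝ) (i : V) :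
    fderiv ℝ (T.curvatureDefect Φ) u x i =
      ∑ j, T.edgeConductance Φ (metricOfLog u) i j * (x i - x j) -
        T.averageCurvature Φ (metricOfLog u) * (Real.exp (u i) * x i -
          Real.exp (u i) * (∑ j, Real.exp (u j) * x j) / ∑ j, Real.exp (u j)) := by
  have hline (k : V) : HasDerivAt (fun s : ℝ => (u + s • x) k) (x k) 0 := by
    simpa using ((hasDerivAt_id' (0 : ℝ)).mul_const (x k)).const_add (u k)
  have hline' : HasDerivAt (fun s : ℝ => u + s • x) x 0 := hasDerivAt_pi.2 hline
  have h0 : u + (0 : ℝ) • x = u := by simp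
  have hG : HasFDerivAt (T.curvatureDefect Φ) (fderiv ℝ (T.curvatureDefect Φ) u)
      (u + (0 : ℝ) • x) := by
    rw [h0]
    exact ((contDiff_curvatureDefect hΦ).differentiable one_ne_zero u).hasFDerivAt
  have h1 := hasDerivAt_pi.1 (hG.comp_hasDerivAt (0 : ℝ) hline') i
  have hK (i : V) : HasDerivAt (fun s : ℝ => T.angleDeficit Φ (metricOfLog (u + s • x)) i)
      (∑ j, T.edgeConductance Φ (metricOfLog u) i j * (x i - x j)) 0 := by
    simpa only [h0] using hasDerivAt_angleDeficit hΦ hline i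
  have hE (i : V) : HasDerivAt (fun s : ℝ => Real.exp ((u + s • x) i)) (Real.exp (u i) * x i) 0 := by
    simpa only [h0] using (hline i).exp
  have hsK := HasDerivAt.fun_sum fun i (_ : i ∈ Finset.univ) => hK i
  have hsE := HasDerivAt.fun_sum fun i (_ : i ∈ Finset.univ) => hE i
  have hS := T.sum_exp_pos u
  have h2 := (hK i).sub ((hsK.div hsE (T.sum_exp_pos _).ne').mul (hE i))
  refine (h1.unique (h2.congr_of_eventuallyEq (.of_forall fun s => ?_))).trans ?_
  · simp only [Function.comp_apply, curvatureDefect, averageCurvature_metricOfLog, Pi.sub_apply,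
      Pi.mul_apply, Pi.div_apply]
  simp only [h0, averageCurvature_metricOfLog, sum_edgeConductance_mul_eq_zero, Pi.div_apply]
  field_simp
  ring

lemma sum_curvatureDefect (u : V → ℝ) : ∑ i, T.curvatureDefect Φ u i = 0 := by
  simp only [curvatureDefect, Finset.sum_sub_distrib, ← Finset.mul_sum]
  rw [averageCurvature_metricOfLog, div_mul_cancel₀ _ (T.sum_exp_pos u).ne', sub_self]

lemma lt_of_hasEigenvalue {r : V → ℝ}
    (h : T.averageCurvature Φ r < T.firstPositiveEigenvalue Φ r) {μ : ℝ} (hμ : 0 < μ)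
    (hev : Module.End.HasEigenvalue (-T.laplacian Φ r) μ) : T.averageCurvature Φ r < μ :=
  h.trans_le (csInf_le ⟨0, fun _ h => h.1.le⟩ ⟨hμ, hev⟩)

lemma isConvexGradientField_curvatureDefect (hΦ : T.IsWeight Φ)
    (hlam : ∀ r : V → ℝ, IsCirclePackingMetric r →
      T.averageCurvature Φ r < T.firstPositiveEigenvalue Φ r) :
    IsConvexGradientField (T.curvatureDefect Φ) where
  contDiff := contDiff_curvatureDefect hΦ
  symm u x y := by
    have hsym := edgeConductance_comm (T := T) (Φ := Φ) (metricOfLog u)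
    have key (x y : V → ℝ) : pairing (fderiv ℝ (T.curvatureDefect Φ) u x) y =
        ∑ i, (∑ j, T.edgeConductance Φ (metricOfLog u) i j * (x i - x j)) * y i -
          T.averageCurvature Φ (metricOfLog u) * (∑ i, Real.exp (u i) * (x i * y i) -
            (∑ j, Real.exp (u j) * x j) * (∑ i, Real.exp (u i) * y i) /
              ∑ j, Real.exp (u j)) := by
      simp only [pairing_apply, fderiv_curvatureDefect hΦ]
      generalize ∑ j, Real.exp (u j) * x j = B
      generalize ∑ j, Real.exp (u j) = S
      rw [mul_div_right_comm, Finset.mul_sum _ _ (B / S), ← Finset.sum_sub_distrib,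
        Finset.mul_sum, ← Finset.sum_sub_distrib]
      exact Finset.sum_congr rfl fun i _ => by ring
    rw [key, key, sum_conductance_mul hsym, sum_conductance_mul hsym]
    simp only [mul_comm (x _) (y _), mul_comm (x _ - x _) (y _ - y _),
      mul_comm (∑ i, Real.exp (u i) * x i) (∑ i, Real.exp (u i) * y i)]
  pos u x hx := by
    have hr := metricOfLog_pos u
    have hsym := edgeConductance_comm (T := T) (Φ := Φ) (metricOfLog u)
    have hS := T.sum_exp_pos u
    set S := ∑ j, Real.exp (u j) with hSdef
    -- The weighted mean of `x`. The energy ignores the shift by `a`, and the term with `R_av` is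
    -- the variance of `x`, so the claim is the Poincaré inequality for `x - a`.
    set a := (∑ j, Real.exp (u j) * x j) / S with ha
    have haS : ∑ j, Real.exp (u j) * x j = a * S := (div_mul_cancel₀ _ hS.ne').symm
    have h := dirichlet_gt_of_eigenvalues_gt hsym (edgeConductance_nonneg hΦ hr)
      (fun f hf => eq_of_conductance hΦ hr hf) (fun i => Real.exp_pos (u i))
      (D := T.laplacian Φ (metricOfLog u)) (fun f i => by
        rw [laplacian_apply hΦ hr, metricOfLog_sq, one_div, ← mul_assoc,
          mul_inv_cancel₀ (Real.exp_pos _).ne', one_mul])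
      (fun μ hμ hev => lt_of_hasEigenvalue (hlam _ hr) hμ hev)
      (x := fun i => x i - a) (fun h0 => hx ⟨a, fun i => sub_eq_zero.1 (congrFun h0 i)⟩)
      (by simp only [mul_sub, Finset.sum_sub_distrib, ← Finset.sum_mul]
          rw [haS, ← hSdef]; ring)
    have h1 : ∑ i, Real.exp (u i) * (x i - a) ^ 2 =
        ∑ i, (Real.exp (u i) * x i - Real.exp (u i) * a) * x i := by
      have : ∑ i, Real.exp (u i) * (x i - a) ^ 2 =
          ∑ i, (Real.exp (u i) * x i - Real.exp (u i) * a) * x i -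
            a * (∑ i, Real.exp (u i) * x i - a * ∑ i, Real.exp (u i)) := by
        rw [Finset.mul_sum _ _ a, ← Finset.sum_sub_distrib, Finset.mul_sum,
          ← Finset.sum_sub_distrib]
        exact Finset.sum_congr rfl fun i _ => by ring
      rw [this, haS, ← hSdef, sub_self, mul_zero, sub_zero]
    rw [h1, sum_conductance_mul hsym] at h
    simp only [sub_sub_sub_cancel_right] at h
    rw [← sum_conductance_mul hsym, Finset.mul_sum] at h
    rw [pairing_apply]
    simp only [fderiv_curvatureDefect hΦ, mul_div_assoc, ← hSdef, ← ha, sub_mul, mul_assoc,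
      Finset.sum_sub_distrib] at h ⊢
    simpa [Finset.sum_sub_distrib, Finset.mul_sum, mul_sub, sub_mul, mul_assoc] using h
  sum_eq_zero := sum_curvatureDefect

lemma weightedDescentField_curvatureDefect (u : V → ℝ) (i : V) :
    weightedDescentField (T.curvatureDefect Φ) u i =
      T.averageCurvature Φ (metricOfLog u) - T.curvature Φ (metricOfLog u) i := by
  rw [weightedDescentField, curvatureDefect, curvature, metricOfLog_sq, Real.exp_neg]
  field_simp
  ring

lemma curvatureDefect_eq (u : V → ℝ) (i : V) : T.curvatureDefect Φ u i =
    -((T.averageCurvature Φ (metricOfLog u) - T.curvature Φ (metricOfLog u) i) *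
      metricOfLog u i ^ 2) := by
  rw [curvatureDefect, curvature, metricOfLog_sq]
  field_simp
  ring

lemma isConstantCurvatureMetric_of_curvatureDefect_eq_zero {u : V → ℝ}
    (h : T.curvatureDefect Φ u = 0) : T.IsConstantCurvatureMetric Φ (metricOfLog u) := by
  refine ⟨metricOfLog_pos u, T.averageCurvature Φ (metricOfLog u), fun i => ?_⟩
  have h1 := congrFun h i
  rw [curvatureDefect_eq, Pi.zero_apply, neg_eq_zero, mul_eq_zero] at h1
  exact (sub_eq_zero.1 (h1.resolve_right (pow_pos (metricOfLog_pos u i) 2).ne')).symm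

lemma curvatureDefect_eq_zero_of_isConstantCurvatureMetric {u : V → ℝ}
    (h : T.IsConstantCurvatureMetric Φ (metricOfLog u)) : T.curvatureDefect Φ u = 0 := by
  obtain ⟨hr, c, hc⟩ := h
  have hav : T.averageCurvature Φ (metricOfLog u) = c := by
    simp only [averageCurvature, hc, ← Finset.mul_sum, metricOfLog_sq]
    exact mul_div_cancel_right₀ _ (T.sum_exp_pos u).ne'
  funext i
  rw [curvatureDefect_eq, hav, hc, sub_self, zero_mul, neg_zero, Pi.zero_apply]

lemma IsConstantCurvatureMetric.mul {r : V → ℝ} (h : T.IsConstantCurvatureMetric Φ r) {c : ℝ}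
    (hc : 0 < c) : T.IsConstantCurvatureMetric Φ (fun i => c * r i) := by
  obtain ⟨hr, κ, hκ⟩ := h
  refine ⟨fun i => mul_pos hc (hr i), κ / c ^ 2, fun i => ?_⟩
  rw [← hκ i, curvature, curvature, angleDeficit_mul hc, mul_pow, div_div, mul_comm (r i ^ 2)]

/-- A constant curvature metric can be scaled to any given total area `∑ i, r i ^ 2`. -/
lemma exists_curvatureDefect_eq_zero {r : V → ℝ} (h : T.IsConstantCurvatureMetric Φ r) {S : ℝ}
    (hS : 0 < S) : ∃ u, T.curvatureDefect Φ u = 0 ∧ ∑ i, Real.exp (u i) = S := by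
  set v := logOfMetric r
  have hv : metricOfLog v = r := metricOfLog_log h.1
  have hv0 := T.sum_exp_pos v
  set c := Real.log (S / ∑ i, Real.exp (v i))
  refine ⟨fun i => v i + c, curvatureDefect_eq_zero_of_isConstantCurvatureMetric ?_, ?_⟩
  · rw [metricOfLog_add_const, hv]
    exact h.mul (Real.exp_pos _)
  · simp only [Real.exp_add, ← Finset.sum_mul]
    rw [Real.exp_log (div_pos hS hv0), mul_div_cancel₀ _ hv0.ne']

lemma isNormalizedRicciFlow_metricOfLog {u : ℝ → V → ℝ}
    (hu : ∀ t, 0 ≤ t → HasDerivWithinAt u (weightedDescentField (T.curvatureDefect Φ) (u t))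
      (Set.Ici 0) t) :
    T.IsNormalizedRicciFlow Φ (metricOfLog (u 0)) (fun t => metricOfLog (u t)) where
  initial := rfl
  isMetric _ _ := metricOfLog_pos _
  evolution t ht i := by
    simp only [metricOfLog_sq]
    have h := (hasDerivWithinAt_pi.1 (hu t ht) i).exp
    rwa [weightedDescentField_curvatureDefect, mul_comm] at h

lemma IsNormalizedRicciFlow.hasDerivWithinAt_logOfMetric {r₀ : V → ℝ} {r : ℝ → V → ℝ}
    (h : T.IsNormalizedRicciFlow Φ r₀ r) {t : ℝ} (ht : 0 ≤ t) :
    HasDerivWithinAt (fun t => logOfMetric (r t))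
      (weightedDescentField (T.curvatureDefect Φ) (logOfMetric (r t))) (Set.Ici 0) t := by
  refine hasDerivWithinAt_pi.2 fun i => ?_
  have hpos := pow_pos (h.isMetric t ht i) 2
  refine ((h.evolution t ht i).log hpos.ne').congr_deriv ?_
  rw [weightedDescentField_curvatureDefect, metricOfLog_logOfMetric (h.isMetric t ht),
    mul_div_cancel_right₀ _ hpos.ne']

omit [Fintype V] [DecidableEq V] in
lemma tendsto_logOfMetric {r : ℝ → V → ℝ} {rlim : V → ℝ} (hpos : IsCirclePackingMetric rlim)
    (hlim : Tendsto r atTop (𝓝 rlim)) :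
    Tendsto (fun t => logOfMetric (r t)) atTop (𝓝 (logOfMetric rlim)) :=
  tendsto_pi_nhds.2 fun i => ((tendsto_pi_nhds.1 hlim i).pow 2).log (pow_pos (hpos i) 2).ne'

/-- The derivative of `r i ^ 2` is minus the defect, which converges by continuity because the limit
metric is positive. -/
lemma IsNormalizedRicciFlow.curvatureDefect_limit_eq_zero (hΦ : T.IsWeight Φ) {r₀ : V → ℝ}
    {r : ℝ → V → ℝ} (h : T.IsNormalizedRicciFlow Φ r₀ r) {rlim : V → ℝ}
    (hpos : IsCirclePackingMetric rlim) (hlim : Tendsto r atTop (𝓝 rlim)) :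
    T.curvatureDefect Φ (logOfMetric rlim) = 0 := by
  funext i
  have hd (t : ℝ) (ht : 0 ≤ t) : HasDerivWithinAt (fun s => r s i ^ 2)
      (-T.curvatureDefect Φ (logOfMetric (r t)) i) (Set.Ici 0) t := by
    rw [curvatureDefect_eq, neg_neg, metricOfLog_logOfMetric (h.isMetric t ht)]
    exact h.evolution t ht i
  have hc : Tendsto (fun t => -T.curvatureDefect Φ (logOfMetric (r t)) i) atTop
      (𝓝 (-T.curvatureDefect Φ (logOfMetric rlim) i)) :=
    (tendsto_pi_nhds.1 (((contDiff_curvatureDefect hΦ).continuous.tendsto _).comp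
      (tendsto_logOfMetric hpos hlim)) i).neg
  exact neg_eq_zero.1 (eq_zero_of_tendsto_of_hasDerivWithinAt hd
    ((tendsto_pi_nhds.1 hlim i).pow 2) hc)

lemma IsNormalizedRicciFlow.isConstantCurvatureMetric_limit (hΦ : T.IsWeight Φ) {r₀ : V → ℝ}
    {r : ℝ → V → ℝ} (h : T.IsNormalizedRicciFlow Φ r₀ r) {rlim : V → ℝ}
    (hpos : IsCirclePackingMetric rlim) (hlim : Tendsto r atTop (𝓝 rlim)) :
    T.IsConstantCurvatureMetric Φ rlim := by
  have h1 := isConstantCurvatureMetric_of_curvatureDefect_eq_zero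
    (h.curvatureDefect_limit_eq_zero hΦ hpos hlim)
  rwa [metricOfLog_logOfMetric hpos] at h1

end TriangulatedSurface

end

/-! ### The theorem. -/

open TriangulatedSurface in
theorem mainTheorem7 {V : Type*} [Fintype V] [DecidableEq V]
    (T : TriangulatedSurface V) (Φ : Sym2 V → ℝ) (hΦ : T.IsWeight Φ)
    (hlam : ∀ r : V → ℝ, IsCirclePackingMetric r →
      T.averageCurvature Φ r < T.firstPositiveEigenvalue Φ r)
    (r₀ : V → ℝ) (hr₀ : IsCirclePackingMetric r₀) :
    ((∃ r : ℝ → V → ℝ, T.IsNormalizedRicciFlow Φ r₀ r ∧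
        ∃ rlim : V → ℝ, IsCirclePackingMetric rlim ∧ Tendsto r atTop (𝓝 rlim)) ↔
      ∃ rstar : V → ℝ, T.IsConstantCurvatureMetric Φ rstar) ∧
    (∀ r : ℝ → V → ℝ, T.IsNormalizedRicciFlow Φ r₀ r →
      ∀ rlim : V → ℝ, IsCirclePackingMetric rlim → Tendsto r atTop (𝓝 rlim) →
        T.IsConstantCurvatureMetric Φ rlim ∧
        ∃ C a : ℝ, 0 < C ∧ 0 < a ∧
          ∀ t : ℝ, 0 ≤ t → ∀ i : V, |r t i - rlim i| ≤ C * Real.exp (-a * t)) := by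
  have := T.nonempty
  have hG := isConvexGradientField_curvatureDefect hΦ hlam
  refine ⟨⟨fun ⟨r, hr, rlim, hpos, hlim⟩ =>
    ⟨rlim, hr.isConstantCurvatureMetric_limit hΦ hpos hlim⟩, fun ⟨rstar, hstar⟩ => ?_⟩,
    fun r hr rlim hpos hlim => ⟨hr.isConstantCurvatureMetric_limit hΦ hpos hlim, ?_⟩⟩
  -- Since the flow conserves area, the constant curvature metric is first scaled to the area of
  -- `r₀`.
  · obtain ⟨v, hv0, hvS⟩ := exists_curvatureDefect_eq_zero hstar
      (T.sum_exp_pos (logOfMetric r₀))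
    obtain ⟨u, R, hu0, hu, hR⟩ := hG.exists_bounded_flow hv0 hvS.symm
    obtain ⟨C, a, -, ha, hC⟩ := hG.exists_exp_decay hv0 hu (by rw [hu0, hvS]) hR
    have hlim : Tendsto u atTop (𝓝 v) := by
      refine tendsto_iff_norm_sub_tendsto_zero.2 (squeeze_zero' (.of_forall fun _ => norm_nonneg _)
        (eventually_ge_atTop (0 : ℝ) |>.mono hC) ?_)
      rw [← mul_zero C]
      refine (Real.tendsto_exp_atBot.comp ?_).const_mul C
      exact tendsto_id.const_mul_atTop_of_neg (neg_neg_of_pos ha)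
    refine ⟨fun t => metricOfLog (u t), ?_, metricOfLog v, metricOfLog_pos v, ?_⟩
    · have := isNormalizedRicciFlow_metricOfLog hu
      rwa [hu0, metricOfLog_logOfMetric hr₀] at this
    · exact tendsto_pi_nhds.2 fun i => ((tendsto_pi_nhds.1 hlim i).div_const 2).rexp
  · set u : ℝ → V → ℝ := fun t => logOfMetric (r t) with hudef
    set v := logOfMetric rlim with hvdef
    have hu : ∀ t, 0 ≤ t → HasDerivWithinAt u
        (weightedDescentField (T.curvatureDefect Φ) (u t)) (Set.Ici 0) t :=
      fun t ht => hr.hasDerivWithinAt_logOfMetric ht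
    have hv0 : T.curvatureDefect Φ v = 0 := hr.curvatureDefect_limit_eq_zero hΦ hpos hlim
    have hulim : Tendsto u atTop (𝓝 v) := tendsto_logOfMetric hpos hlim
    obtain ⟨R, hR⟩ := exists_norm_sub_le_of_tendsto
      (fun t ht => (hu t ht).continuousWithinAt) hulim
    -- The conserved area passes to the limit.
    have hsum : ∑ i, Real.exp (u 0 i) = ∑ i, Real.exp (v i) := by
      have h1 : Tendsto (fun t => ∑ i, Real.exp (u t i)) atTop (𝓝 (∑ i, Real.exp (v i))) :=
        tendsto_finsetSum _ fun i _ => (tendsto_pi_nhds.1 hulim i).rexp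
      refine tendsto_nhds_unique (tendsto_const_nhds.congr' ?_) h1
      filter_upwards [eventually_ge_atTop 0] with t ht
      exact (sum_exp_eq_of_flow (a := fun _ => 1) hG (by simpa using hu) ht).symm
    obtain ⟨C, a, hC0, ha, hC⟩ := hG.exists_exp_decay hv0 hu hsum hR
    -- The first factor is a Lipschitz constant of `exp` on the range of the exponents `u t i / 2`
    -- and `v i / 2`.
    refine ⟨Real.exp ((‖v‖ + R) / 2) * C, a, by positivity, ha, fun t ht i => ?_⟩
    have hR0 : 0 ≤ R := (norm_nonneg _).trans (hR 0 le_rfl)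
    have h1 : u t i ≤ ‖v‖ + R := by
      calc u t i ≤ ‖u t‖ := (Real.le_norm_self _).trans (norm_le_pi_norm _ i)
        _ = ‖v + (u t - v)‖ := by rw [add_sub_cancel]
        _ ≤ ‖v‖ + R := (norm_add_le _ _).trans (by gcongr; exact hR t ht)
    have h2 : v i ≤ ‖v‖ + R :=
      ((Real.le_norm_self _).trans (norm_le_pi_norm v i)).trans (by linarith)
    have h3 : |u t i - v i| ≤ C * Real.exp (-a * t) :=
      (norm_le_pi_norm (u t - v) i).trans (hC t ht)
    have h4 : r t i = Real.exp (u t i / 2) :=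
      (congrFun (metricOfLog_log (hr.isMetric t ht)) i).symm
    have h5 : rlim i = Real.exp (v i / 2) := (congrFun (metricOfLog_log hpos) i).symm
    rw [h4, h5, mul_assoc]
    refine (abs_exp_sub_exp_le (B := (‖v‖ + R) / 2) (by linarith) (by linarith)).trans ?_
    gcongr
    rw [← sub_div, abs_div, abs_two]
    linarith [abs_nonneg (u t i - v i)]
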